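/- Let $k$ be a field of characteristic $0$, let $n\ge 1$, and let $W=\mathfrak S_{n+1}$ with simple reflections $s_i=(i\ i{+}1)$, $1\le i\le n$. Let $D$ be its Coxeter graph, i.e. the path with vertices $1<2<\dots<n$. For $B\subseteq D$ let $W_B$ be the standard parabolic subgroup generated by the $s_i$, $i\in B$. The group algebra $kW$ is a $D$-algebra through its subalgebras $kW_B$, for $B$ a connected (in particular non-empty) full subgraph of $D$. Its Dynkin complex is $$CD^p(kW)=\bigoplus_{\alpha\subseteq B\subseteq D,\ |\alpha|=p}(kW_B)^{W_{B\setminus\alpha}},$$ where $B$ runs over the connected subdiagrams of $D$, $\alpha$ over the subsets of cardinality $p$ of the vertices of $B$, and $(kW_B)^{W_{B\setminus\alpha}}$ is the centraliser in $kW_B$ of $W_{B\setminus\alpha}$ (equivalently, of the algebras $kW_C$, for $C$ the connected components of $B\setminus\alpha$). Writing $\alpha=\{\alpha_1<\dots<\alpha_{p+1}\}$, the differential is $$(da)_{(B;\alpha)}=\sum_{i=1}^{p+1}(-1)^{i-1}\Bigl(a_{(B;\alpha\setminus\alpha_i)}-\sum_{C}a_{(C;\alpha\setminus\alpha_i)}\Bigr),$$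 where $C$ runs over the connected components of $B\setminus\alpha_i$ that contain $\alpha\setminus\alpha_i$ (at most one if $p\ge1$, all components if $p=0$). For a conjugacy class $c$ of $W$, let $CD_c\subseteq CD(kW)$ be the subcomplex of cochains all of whose components are linear combinations of elements of $c$; then $CD(kW)=\bigoplus_c CD_c$, and $HD^p(kW)_c$ denotes the $p$-th cohomology of $CD_c$. For a partition $\lambda$ of $n+1$ let $c^\lambda$ be the conjugacy class of permutations of cycle type $\lambda$. Let $\mathcal O^*_{m}$ be the set of partitions of $m$ whose parts are odd, pairwise distinct, and all different from $1$. **Theorem.** For every $0\le p\le n$ and every partition $\lambda$ of $n+1$, $$\dim_k HD^p(k\mathfrak S_{n+1})_{c^\lambda}=\begin{cases}1&\text{if }\lambda=\lambda'\cup\{1^{n-p}\}\text{ for some }\lambda'\in\mathcal O^*_{p+1},\\ 0&\text{otherwise.}\end{cases}$$ -/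

import Mathlib

namespace DynkinCohomology

/-- A subset `B` of the vertex set of the diagram `D` spans a connected (non-empty) full
subgraph, i.e. it is a connected subdiagram. -/
def IsConnSub {V : Type*} (D : SimpleGraph V) (B : Finset V) : Prop :=
  (D.induce (B : Set V)).Connected

/-- `C` is a connected component of the full subgraph of `D` on `B` (there is none if `B = ∅`). -/
def IsComponent {V : Type*} (D : SimpleGraph V) (B C : Finset V) : Prop :=
  Maximal (fun C' : Finset V => IsConnSub D C' ∧ C' ⊆ B) C

/-- Orthogonal subdiagrams: no common vertex, and no edge of `D` between them. -/
def Orthogonal {V : Type*} (D : SimpleGraph V) (B B' : Finset V) : Prop :=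
  Disjoint B B' ∧ ∀ i ∈ B, ∀ j ∈ B', ¬ D.Adj i j

/-- A `D`-algebra structure on `A`: subalgebras `A_B`, for the connected subdiagrams `B` of `D`,
increasing in `B`, and commuting for orthogonal subdiagrams.  (Values of `sub` at subsets which
are not connected carry no information and are never used.) -/
structure DAlgebra (k : Type*) {V : Type*} (A : Type*) [CommRing k] [Ring A] [Algebra k A]
    (D : SimpleGraph V) where
  sub : Finset V → Subalgebra k A
  sub_mono : ∀ B B' : Finset V, IsConnSub D B → IsConnSub D B' → B ⊆ B' → sub B ≤ sub B'
  sub_comm : ∀ B B' : Finset V, IsConnSub D B → IsConnSub D B' → Orthogonal D B B' →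
    ∀ x ∈ sub B, ∀ y ∈ sub B', x * y = y * x

/-- `A_{B₁}^{B₂}`: the centraliser in `A_{B₁}` of the subalgebras `A_C`, for `C` running over the
connected components of `B₂`. -/
def DAlgebra.cent {k V A : Type*} [CommRing k] [Ring A] [Algebra k A] {D : SimpleGraph V}
    (S : DAlgebra k A D) (B₁ B₂ : Finset V) : Subalgebra k A :=
  S.sub B₁ ⊓ Subalgebra.centralizer k {x : A | ∃ C : Finset V, IsComponent D B₂ C ∧ x ∈ S.sub C}

/-- The Dynkin `p`-cochains `CD^p(A) = ⨁ A_B^{B ∖ α}`, the sum being over the connected subdiagrams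
`B` of `D` and the (unordered) subsets `α ⊆ B` of cardinality `p`.  A cochain is recorded as the
function `(B, α) ↦ a_{(B; α)}`, extended by zero to all other pairs `(B, α)`.  Antisymmetric
families indexed by ordered subsets are identified with such functions by means of a total
order on `V`: only the values at increasingly ordered subsets are recorded. -/
def DAlgebra.cochains {k V A : Type*} [CommRing k] [Ring A] [Algebra k A] [LinearOrder V]
    {D : SimpleGraph V} (S : DAlgebra k A D) (p : ℕ) :
    Submodule k (Finset V → Finset V → A) where
  carrier := {a |
    (∀ B α : Finset V, IsConnSub D B → α ⊆ B → α.card = p → a B α ∈ S.cent B (B \ α)) ∧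
    (∀ B α : Finset V, ¬ (IsConnSub D B ∧ α ⊆ B ∧ α.card = p) → a B α = 0)}
  add_mem' {a b} ha hb :=
    ⟨fun B α h₁ h₂ h₃ => add_mem (ha.1 B α h₁ h₂ h₃) (hb.1 B α h₁ h₂ h₃), fun B α h => by
      simp only [Pi.add_apply, ha.2 B α h, hb.2 B α h, add_zero]⟩
  zero_mem' := ⟨fun B α _ _ _ => zero_mem (S.cent B (B \ α)), fun _ _ _ => rfl⟩
  smul_mem' c a ha :=
    ⟨fun B α h₁ h₂ h₃ => Subalgebra.smul_mem _ (ha.1 B α h₁ h₂ h₃) c, fun B α h => by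
      simp only [Pi.smul_apply, ha.2 B α h, smul_zero]⟩

open Classical in
/-- The finset of connected components of the full subgraph of `D` on `B`. -/
noncomputable def components {V : Type*} (D : SimpleGraph V) (B : Finset V) :
    Finset (Finset V) :=
  B.powerset.filter fun C => IsComponent D B C

open Classical in
/-- The Dynkin differential.  For `α = {α₁ < ⋯ < α_{p+1}} ⊆ B`, with `B` connected,
`(d a)_{(B; α)} = ∑ᵢ (-1)^(i-1) (a_{(B; α ∖ αᵢ)} - ∑_C a_{(C; α ∖ αᵢ)})`,
where `C` runs over the connected components of `B ∖ αᵢ` which contain `α ∖ αᵢ`.  For `p ≥ 1` there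
is at most one such `C`; for `p = 0` all components of `B ∖ αᵢ` occur.
(For `β = αᵢ` the number of elements of `α` smaller than `β` is `i - 1`.) -/
noncomputable def differential (k : Type*) {V A : Type*} [CommRing k] [Ring A] [Algebra k A]
    [LinearOrder V] (D : SimpleGraph V) :
    (Finset V → Finset V → A) →ₗ[k] (Finset V → Finset V → A) where
  toFun a := fun B α =>
    if IsConnSub D B ∧ α ⊆ B then
      ∑ β ∈ α, (-1 : k) ^ (α.filter fun γ => γ < β).card •
        (a B (α.erase β) -
          ∑ C ∈ (components D (B.erase β)).filter (fun C => α.erase β ⊆ C), a C (α.erase β))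
    else 0
  map_add' a b := by
    funext B α
    by_cases h : IsConnSub D B ∧ α ⊆ B
    · simp only [h, and_self, if_true, Pi.add_apply, Finset.sum_add_distrib]
      rw [← Finset.sum_add_distrib]
      exact Finset.sum_congr rfl fun β _ => by rw [← smul_add]; congr 1; abel
    · simp only [h, if_false, Pi.add_apply, add_zero]
  map_smul' c a := by
    funext B α
    by_cases h : IsConnSub D B ∧ α ⊆ B
    · simp only [h, and_self, if_true, Pi.smul_apply, RingHom.id_apply, Finset.smul_sum]
      exact Finset.sum_congr rfl fun β _ => by
        rw [← Finset.smul_sum, ← smul_sub, smul_comm]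
    · simp only [h, if_false, Pi.smul_apply, RingHom.id_apply, smul_zero]

section Cohomology

/-- The `p`-cocycles of the complex `K 0 → K 1 → ⋯` with differential induced by `d`. -/
def cocycles {k M : Type*} [CommRing k] [AddCommGroup M] [Module k M]
    (K : ℕ → Submodule k M) (d : M →ₗ[k] M) (p : ℕ) : Submodule k M :=
  K p ⊓ LinearMap.ker d

/-- The `p`-coboundaries of the complex `K 0 → K 1 → ⋯` with differential induced by `d`. -/
def coboundaries {k M : Type*} [CommRing k] [AddCommGroup M] [Module k M]
    (K : ℕ → Submodule k M) (d : M →ₗ[k] M) : ℕ → Submodule k M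
  | 0 => ⊥
  | p + 1 => (K p).map d

/-- The `p`-th cohomology of the complex `K 0 → K 1 → ⋯` with differential induced by `d`. -/
abbrev Cohomology {k M : Type*} [CommRing k] [AddCommGroup M] [Module k M]
    (K : ℕ → Submodule k M) (d : M →ₗ[k] M) (p : ℕ) : Type _ :=
  cocycles K d p ⧸ (coboundaries K d p).submoduleOf (cocycles K d p)

end Cohomology

section Coxeter

/-- The Coxeter graph of a Coxeter matrix `M`: `i` and `j` are joined iff `i ≠ j` and
`m_{ij} ≠ 2`. -/
def coxeterGraph {I : Type*} (M : CoxeterMatrix I) : SimpleGraph I where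
  Adj i j := i ≠ j ∧ M i j ≠ 2
  symm := ⟨fun i j h => ⟨h.1.symm, by rw [M.symmetric j i]; exact h.2⟩⟩
  loopless := ⟨fun _ h => h.1 rfl⟩

/-- The standard parabolic subgroup `W_B`, generated by the `s i` with `i ∈ B`. -/
def parabolic {I W : Type*} [Group W] (s : I → W) (B : Finset I) : Subgroup W :=
  Subgroup.closure (s '' (B : Set I))

theorem commute_of_orthogonal {I W : Type*} [Group W] (M : CoxeterMatrix I) (s : I → W)
    (hs : M.IsLiftable s) {B B' : Finset I} (h : Orthogonal (coxeterGraph M) B B')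
    {g g' : W} (hg : g ∈ parabolic s B) (hg' : g' ∈ parabolic s B') : g * g' = g' * g := by
  have hsq : ∀ i, s i * s i = 1 := fun i => by simpa using hs i i
  have key : ∀ i ∈ B, ∀ j ∈ B', s i * s j = s j * s i := by
    intro i hi j hj
    have hne : i ≠ j := fun e => Finset.disjoint_left.1 h.1 hi (e ▸ hj)
    have hM : M i j = 2 := by
      by_contra hM
      exact h.2 i hi j hj ⟨hne, hM⟩
    have h2 : (s i * s j) * (s i * s j) = 1 := by
      have := hs i j
      rwa [hM, pow_two] at this
    have h3 := eq_inv_of_mul_eq_one_left h2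
    rwa [mul_inv_rev, inv_eq_of_mul_eq_one_left (hsq i),
      inv_eq_of_mul_eq_one_left (hsq j)] at h3
  have h1 : parabolic s B ≤ Subgroup.centralizer (s '' (B' : Set I)) := by
    refine (Subgroup.closure_le _).2 ?_
    rintro _ ⟨i, hi, rfl⟩
    refine Subgroup.mem_centralizer_iff.2 ?_
    rintro _ ⟨j, hj, rfl⟩
    exact (key i hi j hj).symm
  have h2 : parabolic s B' ≤ Subgroup.centralizer {g} := by
    refine (Subgroup.closure_le _).2 fun x hx => ?_
    refine Subgroup.mem_centralizer_iff.2 ?_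
    rintro _ rfl
    exact (Subgroup.mem_centralizer_iff.1 (h1 hg) x hx).symm
  exact Subgroup.mem_centralizer_iff.1 (h2 hg') g rfl

/-- The group algebra `kW` as an algebra over the Coxeter graph, with `A_B = k W_B` (the image of
the group algebra of the subgroup `W_B` in `kW`).  Here `s` are elements of `W` satisfying the
relations of the Coxeter matrix `M`. -/
noncomputable def groupDAlgebra (k : Type*) {I W : Type*} [CommRing k] [Group W]
    (M : CoxeterMatrix I) (s : I → W) (hs : M.IsLiftable s) :
    DAlgebra k (MonoidAlgebra k W) (coxeterGraph M) where
  sub B := (MonoidAlgebra.mapDomainAlgHom k k (parabolic s B).subtype).range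
  sub_mono B B' _ _ h := by
    rintro _ ⟨x, rfl⟩
    have hle : parabolic s B ≤ parabolic s B' :=
      Subgroup.closure_mono (Set.image_mono (Finset.coe_subset.2 h))
    refine ⟨MonoidAlgebra.mapDomainAlgHom k k (Subgroup.inclusion hle) x, ?_⟩
    change ((MonoidAlgebra.mapDomainAlgHom k k (parabolic s B').subtype).comp
      (MonoidAlgebra.mapDomainAlgHom k k (Subgroup.inclusion hle))) x = _
    rw [← MonoidAlgebra.mapDomainAlgHom_comp]
    rfl
  sub_comm B B' _ _ h := by
    rintro _ ⟨x, rfl⟩ _ ⟨y, rfl⟩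
    induction x using MonoidAlgebra.induction_linear with
    | zero => simp
    | add f g hf hg => simp only [map_add, add_mul, mul_add, hf, hg]
    | single w r =>
      induction y using MonoidAlgebra.induction_linear with
      | zero => simp
      | add f g hf hg => simp only [map_add, add_mul, mul_add, hf, hg]
      | single w' r' =>
        have := commute_of_orthogonal M s hs h w.2 w'.2
        simp [MonoidAlgebra.single_mul_single, this, mul_comm]

/-- `CD^p_c`, for a conjugacy class `c` of `W`: the Dynkin `p`-cochains of `kW` all of whose
components are linear combinations of elements of `c`. -/
noncomputable def classCochains (k : Type*) {I W : Type*} [CommRing k] [Group W] [LinearOrder I]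
    (M : CoxeterMatrix I) (s : I → W) (hs : M.IsLiftable s) (c : Set W) (p : ℕ) :
    Submodule k (Finset I → Finset I → MonoidAlgebra k W) where
  carrier := {a | a ∈ (groupDAlgebra k M s hs).cochains p ∧
    ∀ (B α : Finset I) (g : W), g ∉ c → (a B α).coeff g = 0}
  add_mem' {a b} ha hb := ⟨add_mem ha.1 hb.1, fun B α g hg => by
    simp [ha.2 B α g hg, hb.2 B α g hg]⟩
  zero_mem' := ⟨zero_mem _, fun _ _ _ _ => by simp⟩
  smul_mem' r a ha := ⟨Submodule.smul_mem _ r ha.1, fun B α g hg => by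
    simp [ha.2 B α g hg]⟩

/-- `HD^p_c(kW)`: the `p`-th cohomology of the complex `CD_c` with the Dynkin differential, i.e. the
component at the conjugacy class `c` of the Dynkin diagram cohomology of `kW`. -/
abbrev ClassHD (k : Type*) {I W : Type*} [CommRing k] [Group W] [LinearOrder I]
    (M : CoxeterMatrix I) (s : I → W) (hs : M.IsLiftable s) (c : Set W) (p : ℕ) : Type _ :=
  Cohomology (classCochains k M s hs c)
    (differential k (A := MonoidAlgebra k W) (coxeterGraph M)) p

end Coxeter

section TypeA

/-- The adjacent transpositions, simple reflections of the symmetric group on `n + 1` letters. -/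
def simpleA (n : ℕ) (i : Fin n) : Equiv.Perm (Fin (n + 1)) :=
  Equiv.swap i.castSucc i.succ

theorem simpleA_isLiftable (n : ℕ) : (CoxeterMatrix.A n).IsLiftable (simpleA n) := by
  have h3 : ∀ a b c : Fin (n + 1), a ≠ b → a ≠ c → b ≠ c →
      (Equiv.swap a b * Equiv.swap a c) ^ 3 = 1 := fun a b c h₁ h₂ h₃ => by
    rw [← (Equiv.Perm.isThreeCycle_swap_mul_swap_same h₁ h₂ h₃).orderOf]
    exact pow_orderOf_eq_one _
  intro i j
  change (simpleA n i * simpleA n j) ^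
    (if i = j then 1 else (if (j : ℕ) + 1 = i ∨ (i : ℕ) + 1 = j then 3 else 2)) = 1
  by_cases hij : i = j
  · subst hij
    simp [simpleA]
  have hij' : (i : ℕ) ≠ j := fun h => hij (Fin.ext h)
  rw [if_neg hij]
  by_cases hadj : (j : ℕ) + 1 = i ∨ (i : ℕ) + 1 = j
  · rw [if_pos hadj]
    rcases hadj with h | h
    · have e : i.castSucc = j.succ := Fin.ext (by simp; omega)
      unfold simpleA
      rw [e, Equiv.swap_comm j.castSucc j.succ]
      refine h3 _ _ _ ?_ ?_ ?_ <;> simp [Fin.ext_iff] <;> omega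
    · have e : j.castSucc = i.succ := Fin.ext (by simp; omega)
      unfold simpleA
      rw [e, Equiv.swap_comm i.castSucc i.succ]
      refine h3 _ _ _ ?_ ?_ ?_ <;> simp [Fin.ext_iff] <;> omega
  · rw [if_neg hadj]
    have hd : Equiv.Perm.Disjoint (simpleA n i) (simpleA n j) := by
      refine Equiv.Perm.disjoint_swap_swap ?_
      simp [Fin.ext_iff]
      omega
    rw [hd.commute.mul_pow, pow_two, pow_two]
    simp [simpleA]

/-- The conjugacy class of permutations of cycle type `lam` (fixed points counting as parts
equal to `1`). -/
def classA (n : ℕ) (lam : Nat.Partition (n + 1)) : Set (Equiv.Perm (Fin (n + 1))) :=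
  {σ | σ.partition.parts = lam.parts}

/-- `HD^p(k 𝔖_{n+1})_{c^λ}`. -/
abbrev HDA (k : Type*) [CommRing k] (n p : ℕ) (lam : Nat.Partition (n + 1)) : Type _ :=
  ClassHD k (CoxeterMatrix.A n) (simpleA n) (simpleA_isLiftable n) (classA n lam) p

end TypeA

end DynkinCohomology

/-!
The Dynkin complex of `k 𝔖_{n+1}` is a simplicial complex in disguise. A pair `α ⊆ B`, with `B` an
interval of simple reflections, is the same as a set `t = {t₀ < ⋯ < t_{p+1}}` of cuts between the
points `0, …, n`: the extremal cuts delimit the points moved by `W_B`, and the interior cuts are the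
elements of `α`. The terms `a (C; α ∖ αᵢ)` of the Dynkin differential correspond to the removal of
an extremal cut, so that the differential is, up to sign, the alternating sum over the removal of
one cut (`coeff_differentialA`).

Fix an element `g` of the class whose set of moved points is `{0, …, m - 1}`. A cochain `a` gives
the function `F t w = a t (w⁻¹ g w)`, a cochain on the flags `w {x < t₀} ⊂ w {x < t₁} ⊂ ⋯` of
subsets of `{0, …, n}`, supported on the flags which start outside of `{0, …, m - 1}` and end with a
set containing it. For `2 ≤ m` the cohomology of these flag cochains is one-dimensional, in
degree `m - 1`, and is detected by the alternating sum over the full flags of subsets of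
`{0, …, m - 1}` (`altPairing`). Indeed a cocycle can be eliminated permutation by permutation, in
lexicographic order: at `w` only sets of cuts containing all descents of `w` matter, and toggling
one further cut is a contracting homotopy, except at the reversal of `{0, …, m - 1}`
(`IsFlagCochain.exists_toggle`, `IsFlagCochain.exists_eq_cobd`). Averaging over the `w` with the same
conjugate `w⁻¹ g w`, which is possible in characteristic zero, brings primitives back to class
cochains (`IsClassCochain.exists_eq_cobd`).

Hence the cohomology of the class of `g` has dimension at most one, and is concentrated in the
degree `p` with `p + 1 = m`. If an odd permutation of `{0, …, m - 1}` centralizes `g`, the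
alternating sum of any class cochain vanishes, and so does the cohomology. Otherwise the
determinants `flagDet` give a cocycle with non-zero alternating sum. The centralizer of `g` consists
of even permutations if and only if its cycle lengths are odd and distinct. The class of the
identity is treated separately: there the complex is that of a simplex relative to a path
(`exists_cobd_eq_of_path`).
-/

namespace DynkinCohomology

open Finset Equiv

/-! ### Simplicial cochains on finite subsets of a linear order -/

section Simplicial

variable {ι R : Type*} [LinearOrder ι] [CommRing R]

/-- The simplicial coboundary on functions on finite subsets `t = {t₀ < t₁ < ⋯}` of a linear order:
`(cobd f) t = ∑ⱼ (-1)ʲ f (t ∖ tⱼ)`. -/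
def cobd (f : Finset ι → R) (t : Finset ι) : R :=
  ∑ x ∈ t, (-1) ^ #{y ∈ t | y < x} * f (t.erase x)

/-- The cone construction with apex `v`, a contracting homotopy for `cobd`. -/
def cone (v : ι) (f : Finset ι → R) (t : Finset ι) : R :=
  if v ∈ t then 0 else (-1) ^ #{y ∈ t | y < v} * f (insert v t)

theorem card_filter_erase_lt {t : Finset ι} {x y : ι} (hx : x ∈ t) (h : x < y) :
    #{z ∈ t | z < y} = #{z ∈ t.erase x | z < y} + 1 := by
  have e : ({z ∈ t.erase x | z < y} : Finset ι) = ({z ∈ t | z < y} : Finset ι).erase x := by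
    ext z; simp only [mem_filter, mem_erase]; tauto
  rw [e, card_erase_add_one (by simp [hx, h])]

theorem filter_erase_lt {t : Finset ι} {x y : ι} (h : y ≤ x) :
    ({z ∈ t.erase x | z < y} : Finset ι) = {z ∈ t | z < y} := by
  ext z
  simp only [mem_filter, mem_erase]
  exact ⟨fun H => ⟨H.1.2, H.2⟩, fun H => ⟨⟨fun e => absurd (e ▸ H.2) h.not_gt, H.1⟩, H.2⟩⟩

theorem cobd_cobd (f : Finset ι → R) (t : Finset ι) : cobd (cobd f) t = 0 := by
  unfold cobd
  simp_rw [mul_sum]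
  rw [sum_sigma']
  have key : ∀ x ∈ t, ∀ y ∈ t, x < y →
      (-1 : R) ^ #{z ∈ t | z < x} * ((-1) ^ #{z ∈ t.erase x | z < y} * f ((t.erase x).erase y)) +
      (-1) ^ #{z ∈ t | z < y} * ((-1) ^ #{z ∈ t.erase y | z < x} * f ((t.erase y).erase x)) = 0 := by
    intro x hx y _ h
    rw [card_filter_erase_lt hx h, filter_erase_lt h.le, erase_right_comm]
    ring
  refine sum_involution (fun a _ => ⟨a.2, a.1⟩) ?_ ?_ ?_ ?_
  · rintro ⟨x, y⟩ h
    simp only [mem_sigma, mem_erase] at h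
    rcases lt_or_gt_of_ne h.2.1 with h' | h'
    · rw [add_comm]; exact key y h.2.2 x h.1 h'
    · exact key x h.1 y h.2.2 h'
  · rintro ⟨x, y⟩ h _ e
    simp only [mem_sigma, mem_erase] at h
    exact h.2.1 (congrArg Sigma.fst e)
  · rintro ⟨x, y⟩ h
    simp only [mem_sigma, mem_erase] at h ⊢
    exact ⟨h.2.2, h.2.1.symm, h.1⟩
  · rintro ⟨x, y⟩ _; rfl

theorem cobd_cone_add (v : ι) (f : Finset ι → R) (t : Finset ι) :
    cobd (cone v f) t + cone v (cobd f) t = f t := by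
  by_cases hv : v ∈ t
  · rw [cone, if_pos hv, add_zero, cobd, sum_eq_single_of_mem v hv]
    · rw [cone, if_neg (notMem_erase v t), insert_erase hv, filter_erase_lt le_rfl, ← mul_assoc,
        ← mul_pow]
      simp
    · intro x _ hx
      rw [cone, if_pos (mem_erase.2 ⟨hx.symm, hv⟩), mul_zero]
  · have e : ({y ∈ insert v t | y < v} : Finset ι) = {y ∈ t | y < v} := by
      rw [filter_insert, if_neg (lt_irrefl v)]
    rw [cone, if_neg hv, cobd, cobd, sum_insert hv, erase_insert hv, mul_add, e, ← mul_assoc,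
      ← mul_pow, mul_sum, ← add_assoc, add_right_comm, ← sum_add_distrib]
    rw [sum_eq_zero, zero_add]
    · simp
    · intro x hx
      have hxv : x ≠ v := fun h => hv (h ▸ hx)
      rw [cone, if_neg (fun h => hv (mem_of_mem_erase h)), erase_insert_of_ne hxv.symm]
      rcases lt_or_gt_of_ne hxv with h | h
      · rw [card_filter_erase_lt hx h, filter_insert, if_neg h.not_gt]
        ring
      · rw [filter_erase_lt h.le, filter_insert, if_pos h, card_insert_of_notMem (by simp [hv])]
        ring

theorem cobd_sub (f g : Finset ι → R) (t : Finset ι) :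
    cobd (fun t => f t - g t) t = cobd f t - cobd g t := by
  simp only [cobd, mul_sub, sum_sub_distrib]

theorem cobd_sum {κ : Type*} (s : Finset κ) (f : κ → Finset ι → R) (t : Finset ι) :
    cobd (fun t => ∑ j ∈ s, f j t) t = ∑ j ∈ s, cobd (f j) t := by
  simp only [cobd, mul_sum]
  exact sum_comm

theorem cobd_const_mul (r : R) (f : Finset ι → R) (t : Finset ι) :
    cobd (fun t => r * f t) t = r * cobd f t := by
  simp only [cobd, mul_sum, mul_left_comm]

end Simplicial

/-! ### Cuts, Young subgroups and the lexicographic order -/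

section Cuts

variable {n : ℕ}

/-- A cut `c ∈ {0, …, n + 1}` separates the points `x < c` of `{0, …, n}` from the points `c ≤ x`.
The finite set of cuts `t` encloses the point `x` if `min t ≤ x < max t`. -/
def Encloses (t : Finset (Fin (n + 2))) (x : Fin (n + 1)) : Prop :=
  (∃ c ∈ t, (c : ℕ) ≤ x) ∧ ∃ c ∈ t, (x : ℕ) < c

/-- The cut `i + 1` between the points `i` and `i + 1`, which are exchanged by the `i`-th simple
reflection. -/
def cutAt (i : Fin n) : Fin (n + 2) := i.succ.castSucc

@[simp] theorem val_cutAt (i : Fin n) : (cutAt i : ℕ) = i + 1 := by simp [cutAt]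

theorem cutAt_injective : Function.Injective (cutAt : Fin n → Fin (n + 2)) := by
  intro i j h
  have := congrArg Fin.val h
  simp at this
  exact Fin.ext this

/-- The Young subgroup of a set of cuts: the permutations preserving each block of points between
consecutive cuts. -/
def young (t : Finset (Fin (n + 2))) : Subgroup (Perm (Fin (n + 1))) where
  carrier := {v | ∀ x, ∀ c ∈ t, ((v x : ℕ) < c ↔ (x : ℕ) < c)}
  one_mem' := fun _ _ _ => Iff.rfl
  mul_mem' {u v} hu hv := fun x c hc => (hu (v x) c hc).trans (hv x c hc)
  inv_mem' {v} hv := fun x c hc => by simpa using (hv (v⁻¹ x) c hc).symm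

theorem simpleA_inv (i : Fin n) : (simpleA n i)⁻¹ = simpleA n i := swap_inv _ _

theorem simpleA_mul_self (i : Fin n) : simpleA n i * simpleA n i = 1 := swap_mul_self _ _

theorem simpleA_apply_of_lt {i : Fin n} {x : Fin (n + 1)} (h : (x : ℕ) < i) :
    simpleA n i x = x := by
  apply swap_apply_of_ne_of_ne <;> simp [Fin.ext_iff] <;> omega

theorem simpleA_apply_of_gt {i : Fin n} {x : Fin (n + 1)} (h : (i : ℕ) + 1 < x) :
    simpleA n i x = x := by
  apply swap_apply_of_ne_of_ne <;> simp [Fin.ext_iff] <;> omega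

theorem simpleA_castSucc (i : Fin n) : simpleA n i i.castSucc = i.succ := swap_apply_left _ _

theorem simpleA_succ (i : Fin n) : simpleA n i i.succ = i.castSucc := swap_apply_right _ _

theorem val_simpleA_lt_iff (i : Fin n) (x : Fin (n + 1)) {c : ℕ} (hc : c ≠ i + 1) :
    (simpleA n i x : ℕ) < c ↔ (x : ℕ) < c := by
  rcases lt_or_ge (x : ℕ) i with h | h
  · rw [simpleA_apply_of_lt h]
  rcases lt_or_ge ((i : ℕ) + 1) x with h' | h'
  · rw [simpleA_apply_of_gt h']
  rcases (by omega : (x : ℕ) = i ∨ (x : ℕ) = i + 1) with e | e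
  · rw [show x = i.castSucc from Fin.ext (by simp [e]), simpleA_castSucc]; simp; omega
  · rw [show x = i.succ from Fin.ext (by simp [e]), simpleA_succ]; simp; omega

theorem simpleA_mem_young {i : Fin n} {t : Finset (Fin (n + 2))} (h : cutAt i ∉ t) :
    simpleA n i ∈ young t := fun x c hc =>
  val_simpleA_lt_iff i x fun e => h (by rwa [show cutAt i = c from Fin.ext (by simp [e])])

theorem encloses_of_mem_young {t : Finset (Fin (n + 2))} {v : Perm (Fin (n + 1))}
    (hv : v ∈ young t) {x : Fin (n + 1)} : Encloses t (v x) ↔ Encloses t x := by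
  have h1 : ∀ c ∈ t, ((c : ℕ) ≤ v x ↔ (c : ℕ) ≤ x) := fun c hc => by
    have := hv x c hc; omega
  unfold Encloses
  exact and_congr (exists_congr fun c => and_congr_right fun hc => h1 c hc)
    (exists_congr fun c => and_congr_right fun hc => hv x c hc)

/-- The lexicographic key of a permutation, read as the word `w 0, w 1, …, w n`. -/
def lexKey (w : Perm (Fin (n + 1))) : Lex (Fin (n + 1) → Fin (n + 1)) := toLex ⇑w

theorem lexKey_injective : Function.Injective (lexKey : Perm (Fin (n + 1)) → _) :=
  fun _ _ h => DFunLike.coe_injective (toLex.injective h)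

theorem lexKey_lt_iff {u w : Perm (Fin (n + 1))} :
    lexKey u < lexKey w ↔ ∃ x, (∀ y < x, u y = w y) ∧ u x < w x := Iff.rfl

theorem lexKey_mul_simpleA_lt {w : Perm (Fin (n + 1))} {i : Fin n}
    (h : w i.succ < w i.castSucc) : lexKey (w * simpleA n i) < lexKey w := by
  refine lexKey_lt_iff.2 ⟨i.castSucc, fun y hy => ?_, ?_⟩
  · rw [Perm.mul_apply, simpleA_apply_of_lt (by simpa [Fin.lt_def] using hy)]
  · rwa [Perm.mul_apply, simpleA_castSucc]

/-- A permutation increasing at every step between the points `x ≤ y` is increasing from `x`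
to `y`. -/
theorem lt_of_steps {w : Perm (Fin (n + 1))} {x : Fin (n + 1)} :
    ∀ {y : Fin (n + 1)}, x < y →
    (∀ i : Fin n, (x : ℕ) ≤ i → (i : ℕ) < y → w i.castSucc < w i.succ) → w x < w y := by
  intro y
  induction y using Fin.induction with
  | zero => intro h; exact absurd h (Fin.not_lt_zero x)
  | succ i ih =>
    intro h hs
    have hxi : (x : ℕ) ≤ i := by have := Fin.lt_def.1 h; simp at this; omega
    have h1 := hs i hxi (by simp)
    rcases hxi.eq_or_lt with e | e
    · rwa [show x = i.castSucc from Fin.ext (by simp [e])]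
    · exact (ih (by simpa [Fin.lt_def] using e) fun j hj hj' =>
        hs j hj (by simp at hj' ⊢; omega)).trans h1

theorem gt_of_steps {w : Perm (Fin (n + 1))} {x : Fin (n + 1)} :
    ∀ {y : Fin (n + 1)}, x < y →
    (∀ i : Fin n, (x : ℕ) ≤ i → (i : ℕ) < y → w i.succ < w i.castSucc) → w y < w x := by
  intro y
  induction y using Fin.induction with
  | zero => intro h; exact absurd h (Fin.not_lt_zero x)
  | succ i ih =>
    intro h hs
    have hxi : (x : ℕ) ≤ i := by have := Fin.lt_def.1 h; simp at this; omega
    have h1 := hs i hxi (by simp)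
    rcases hxi.eq_or_lt with e | e
    · rwa [show x = i.castSucc from Fin.ext (by simp [e])]
    · exact h1.trans (ih (by simpa [Fin.lt_def] using e) fun j hj hj' =>
        hs j hj (by simp at hj' ⊢; omega))

theorem castSucc_lt_of_not {w : Perm (Fin (n + 1))} {i : Fin n} (h : ¬ w i.succ < w i.castSucc) :
    w i.castSucc < w i.succ :=
  lt_of_le_of_ne (not_lt.1 h) fun e => by
    have := congrArg Fin.val (w.injective e); simp at this

/-- A permutation without descents inside the blocks of `t` is the lexicographically least element
of its coset modulo the Young subgroup of `t`. -/
theorem lexKey_le_of_mem_young {t : Finset (Fin (n + 2))} {w v : Perm (Fin (n + 1))}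
    (hv : v ∈ young t) (hw : ∀ i : Fin n, w i.succ < w i.castSucc → cutAt i ∈ t) :
    lexKey w ≤ lexKey (w * v) := by
  by_contra! h
  obtain ⟨x, h1, h2⟩ := lexKey_lt_iff.1 h
  have hfix : ∀ y < x, v y = y := fun y hy => w.injective (h1 y hy)
  rw [Perm.mul_apply] at h2
  have hx : x < v x := by
    rcases lt_trichotomy (v x) x with h | h | h
    · exact absurd (v.injective (hfix _ h)) h.ne
    · exact absurd (h ▸ h2) (lt_irrefl _)
    · exact h
  refine absurd (lt_of_steps (w := w) hx fun i hi hi' => castSucc_lt_of_not fun hd => ?_) h2.not_gt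
  have := hv x _ (hw i hd)
  rw [val_cutAt] at this
  omega

end Cuts

/-! ### Flag cochains -/

section Equivariant

variable {n : ℕ} {k : Type*} [Field k]

/-- Cochains on pairs of a set of cuts `t` and a permutation `w`, equivalently on flags
`w {x < t₀} ⊂ w {x < t₁} ⊂ ⋯` of subsets of `{0, …, n}`, supported on the flags with `q` members
which start outside of `{0, …, m - 1}` and end with a set containing it. -/
structure IsFlagCochain (m q : ℕ) (F : Finset (Fin (n + 2)) → Perm (Fin (n + 1)) → k) : Prop where
  card : ∀ t w, F t w ≠ 0 → t.card = q
  encl : ∀ t w, F t w ≠ 0 → ∀ i : Fin (n + 1), (i : ℕ) < m → Encloses t (w⁻¹ i)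
  inv : ∀ t w (i : Fin n), cutAt i ∉ t → F t (w * simpleA n i) = F t w

theorem IsFlagCochain.sub {m q : ℕ} {F G : Finset (Fin (n + 2)) → Perm (Fin (n + 1)) → k}
    (hF : IsFlagCochain m q F) (hG : IsFlagCochain m q G) :
    IsFlagCochain m q (fun t w => F t w - G t w) where
  card t w h := by
    by_cases h1 : F t w = 0
    · exact hG.card t w fun h2 => h (by rw [h1, h2, sub_zero])
    · exact hF.card t w h1
  encl t w h := by
    by_cases h1 : F t w = 0
    · exact hG.encl t w fun h2 => h (by rw [h1, h2, sub_zero])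
    · exact hF.encl t w h1
  inv t w i hi := by rw [hF.inv t w i hi, hG.inv t w i hi]

theorem Encloses.mono {t t' : Finset (Fin (n + 2))} (h : t ⊆ t') {x : Fin (n + 1)}
    (hx : Encloses t x) : Encloses t' x :=
  ⟨hx.1.imp fun _ hc => ⟨h hc.1, hc.2⟩, hx.2.imp fun _ hc => ⟨h hc.1, hc.2⟩⟩

theorem IsFlagCochain.cobd {m q : ℕ} {G : Finset (Fin (n + 2)) → Perm (Fin (n + 1)) → k}
    (hG : IsFlagCochain m q G) :
    IsFlagCochain m (q + 1) (fun t w => cobd (fun t => G t w) t) where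
  card t w h := by
    obtain ⟨x, hx, hne⟩ := exists_ne_zero_of_sum_ne_zero h
    rw [← card_erase_add_one hx, hG.card _ w (right_ne_zero_of_mul hne)]
  encl t w h i hi := by
    obtain ⟨x, hx, hne⟩ := exists_ne_zero_of_sum_ne_zero h
    exact (hG.encl _ w (right_ne_zero_of_mul hne) i hi).mono (erase_subset _ _)
  inv t w i hi := by
    unfold DynkinCohomology.cobd
    exact sum_congr rfl fun x _ =>
      congrArg (_ * ·) (hG.inv _ w i fun h => hi (mem_of_mem_erase h))

/-- If a flag cochain vanishes at all permutations before `w`, its value at `(t, w)` vanishes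
unless `t` contains all descents of `w`. -/
theorem IsFlagCochain.cutAt_mem {m q : ℕ} {F : Finset (Fin (n + 2)) → Perm (Fin (n + 1)) → k}
    (hF : IsFlagCochain m q F) {w : Perm (Fin (n + 1))}
    (hw : ∀ u, lexKey u < lexKey w → ∀ t, F t u = 0) {t : Finset (Fin (n + 2))} (ht : F t w ≠ 0)
    {i : Fin n} (hi : w i.succ < w i.castSucc) : cutAt i ∈ t := by
  by_contra h
  exact ht (by rw [← hF.inv t w i h, hw _ (lexKey_mul_simpleA_lt hi)])

open Classical in
/-- Elimination of the value at `w`: toggling a cut `v` which is not a descent of `w` provides a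
cochain whose coboundary agrees with `F` at `w` and vanishes before `w`. -/
theorem IsFlagCochain.exists_cobd_eq {m q : ℕ} {F : Finset (Fin (n + 2)) → Perm (Fin (n + 1)) → k}
    (hF : IsFlagCochain m (q + 1) F) (hd : ∀ t w, DynkinCohomology.cobd (fun t => F t w) t = 0)
    {w : Perm (Fin (n + 1))} (hw : ∀ u, lexKey u < lexKey w → ∀ t, F t u = 0)
    (v : Fin (n + 2)) (hv : ∀ i : Fin n, w i.succ < w i.castSucc → cutAt i ≠ v)
    (henc : ∀ t, v ∉ t → F (insert v t) w ≠ 0 →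
      ∀ i : Fin (n + 1), (i : ℕ) < m → Encloses t (w⁻¹ i)) :
    ∃ G : Finset (Fin (n + 2)) → Perm (Fin (n + 1)) → k, IsFlagCochain m q G ∧
      ∀ u, lexKey u ≤ lexKey w → ∀ t, F t u = DynkinCohomology.cobd (fun t => G t u) t := by
  let G : Finset (Fin (n + 2)) → Perm (Fin (n + 1)) → k := fun t u =>
    if w⁻¹ * u ∈ young t then cone v (fun t => F t w) t else 0
  have hG : ∀ t u, G t u ≠ 0 → w⁻¹ * u ∈ young t ∧ v ∉ t ∧ F (insert v t) w ≠ 0 := by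
    intro t u h
    simp only [G, cone] at h
    split_ifs at h with h1 h2
    · exact absurd rfl h
    · exact ⟨h1, h2, right_ne_zero_of_mul h⟩
    · exact absurd rfl h
  refine ⟨G, ⟨fun t u h => ?_, fun t u h i hi => ?_, fun t u i hi => ?_⟩, fun u hu t => ?_⟩
  · obtain ⟨_, h2, h3⟩ := hG t u h
    have := hF.card _ _ h3
    rw [card_insert_of_notMem h2] at this
    omega
  · obtain ⟨h1, h2, h3⟩ := hG t u h
    have e : u⁻¹ i = (w⁻¹ * u)⁻¹ (w⁻¹ i) := by simp
    rw [e, encloses_of_mem_young ((young t).inv_mem h1)]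
    exact henc t h2 h3 i hi
  · have : w⁻¹ * (u * simpleA n i) ∈ young t ↔ w⁻¹ * u ∈ young t := by
      rw [← mul_assoc]
      exact (young t).mul_mem_cancel_right (simpleA_mem_young hi)
    simp only [G, this]
  · rcases hu.eq_or_lt with e | hlt
    · obtain rfl := lexKey_injective e
      have h1 : (fun t => G t u) = cone v fun t => F t u := by
        funext t; simp [G]
      have h2 := cobd_cone_add v (fun t => F t u) t
      have h3 : DynkinCohomology.cobd (fun t => F t u) = 0 := funext fun t => hd t u
      rw [h1, ← h2, h3]
      simp [cone]
    · rw [hw u hlt]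
      refine (sum_eq_zero fun x _ => ?_).symm
      by_contra hne
      obtain ⟨h1, h2, h3⟩ := hG _ u (right_ne_zero_of_mul hne)
      refine absurd hlt (not_lt.2 ?_)
      have := lexKey_le_of_mem_young (w := w) h1 fun i hi =>
        (mem_insert.1 (hF.cutAt_mem hw h3 hi)).resolve_left (hv i hi)
      rwa [mul_inv_cancel_left] at this

end Equivariant

/-! ### Evaluation at the fundamental cycle -/

section Pairing

variable {n : ℕ} {k : Type*} [Field k]

/-- The set of cuts `{0, …, m}`, whose blocks are the points `0, …, m - 1`. -/
def firstCuts (n m : ℕ) : Finset (Fin (n + 2)) := {c | (c : ℕ) ≤ m}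

theorem ofSubtype_val_lt {m : ℕ} (u : Perm {x : Fin (n + 1) // (x : ℕ) < m}) {x : Fin (n + 1)}
    (hx : (x : ℕ) < m) : (Perm.ofSubtype u x : ℕ) < m := by
  rw [Perm.ofSubtype_apply_of_mem u hx]
  exact (u ⟨x, hx⟩).2

/-- The alternating sum of the values of `F` at the full flags of subsets of `{0, …, m - 1}`, that
is the value of `F` at the fundamental cycle of the Coxeter complex. -/
def altPairing (m : ℕ) (F : Finset (Fin (n + 2)) → Perm (Fin (n + 1)) → k) : k :=
  ∑ u : Perm {x : Fin (n + 1) // (x : ℕ) < m},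
    ((Perm.sign u : ℤ) : k) * F (firstCuts n m) (Perm.ofSubtype u)

theorem altPairing_sub (m : ℕ) (F G : Finset (Fin (n + 2)) → Perm (Fin (n + 1)) → k) :
    altPairing m (fun t w => F t w - G t w) = altPairing m F - altPairing m G := by
  simp only [altPairing, mul_sub, sum_sub_distrib]

theorem altPairing_cobd [CharZero k] {m q : ℕ} (hm : 1 ≤ m) (hmn : m ≤ n + 1)
    {G : Finset (Fin (n + 2)) → Perm (Fin (n + 1)) → k} (hG : IsFlagCochain m q G) :
    altPairing m (fun t w => cobd (fun t => G t w) t) = 0 := by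
  simp only [altPairing, cobd, mul_sum]
  rw [sum_comm]
  refine sum_eq_zero fun c hc => ?_
  have hcm : (c : ℕ) ≤ m := by simpa [firstCuts] using hc
  -- removing an extremal cut leaves a point which is no longer enclosed
  have out : ∀ x : Fin (n + 1), (x : ℕ) < m → ¬ Encloses ((firstCuts n m).erase c) x →
      ∀ u : Perm {x : Fin (n + 1) // (x : ℕ) < m},
        G ((firstCuts n m).erase c) (Perm.ofSubtype u) = 0 := by
    intro x hx hne u
    by_contra h
    refine hne ?_
    simpa using hG.encl _ _ h _ (ofSubtype_val_lt u hx)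
  rcases Nat.eq_zero_or_pos (c : ℕ) with h0 | h0
  · refine sum_eq_zero fun u _ => ?_
    rw [out 0 hm ?_ u, mul_zero, mul_zero]
    rintro ⟨⟨d, hd, hd'⟩, -⟩
    exact (mem_erase.1 hd).1 (Fin.ext (by rw [Fin.val_zero] at hd'; omega))
  rcases hcm.eq_or_lt with h1 | h1
  · refine sum_eq_zero fun u _ => ?_
    rw [out ⟨m - 1, by omega⟩ (by simp; omega) ?_ u, mul_zero, mul_zero]
    rintro ⟨-, d, hd, hd'⟩
    rw [mem_erase] at hd
    have : (d : ℕ) ≤ m := by simpa [firstCuts] using hd.2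
    exact hd.1 (Fin.ext (by simp at hd' ⊢; omega))
  -- removing an interior cut makes the values invariant under an odd permutation
  obtain ⟨j, hj⟩ : ∃ j : Fin n, cutAt j = c := ⟨⟨c - 1, by omega⟩, Fin.ext (by simp; omega)⟩
  have hj' : (j : ℕ) + 1 = c := by rw [← hj, val_cutAt]
  let a : {x : Fin (n + 1) // (x : ℕ) < m} := ⟨j.castSucc, by simp; omega⟩
  let b : {x : Fin (n + 1) // (x : ℕ) < m} := ⟨j.succ, by simp; omega⟩
  have hab : a ≠ b := by simp [a, b, Subtype.ext_iff, Fin.ext_iff]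
  have hs : Perm.ofSubtype (swap a b) = simpleA n j := Perm.ofSubtype_swap_eq a b
  rw [← CharZero.eq_neg_self_iff (R := k)]
  conv_lhs => rw [← Equiv.sum_comp (Equiv.mulRight (swap a b))]
  rw [← sum_neg_distrib]
  refine sum_congr rfl fun u _ => ?_
  rw [Equiv.coe_mulRight, map_mul, map_mul, Perm.sign_swap hab, hs,
    hG.inv _ _ j (by rw [hj]; exact notMem_erase _ _)]
  simp

theorem card_filter_val_lt {m : ℕ} (hmn : m ≤ n + 1) :
    #{x : Fin (n + 1) | (x : ℕ) < m} = m := by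
  rw [Fin.card_filter_val_lt]; omega

theorem card_filter_apply_lt {m : ℕ} (hmn : m ≤ n + 1) (w : Perm (Fin (n + 1))) :
    #{x : Fin (n + 1) | (w x : ℕ) < m} = m := by
  refine Eq.trans ?_ (card_filter_val_lt hmn)
  refine card_bij (fun x _ => w x) (fun x hx => by simpa using hx) (fun _ _ _ _ h => w.injective h)
    fun y hy => ⟨w⁻¹ y, by simpa using hy, by simp⟩

/-- A permutation preserving `{x < m}` and increasing on its complement is the identity there. -/
theorem apply_eq_self_of_increasing {m : ℕ} {w : Perm (Fin (n + 1))}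
    (hw : ∀ x, (w x : ℕ) < m ↔ (x : ℕ) < m)
    (hi : ∀ i : Fin n, m ≤ (i : ℕ) → w i.castSucc < w i.succ) {x : Fin (n + 1)} (hx : m ≤ (x : ℕ)) :
    w x = x := by
  have mono : ∀ x y : Fin (n + 1), m ≤ (x : ℕ) → x < y → w x < w y := fun x y hx hxy =>
    lt_of_steps hxy fun i h _ => hi i (hx.trans h)
  -- an increasing injection of `{x ≥ m}` into itself dominates the identity
  have ge : ∀ v : Perm (Fin (n + 1)), (∀ x : Fin (n + 1), m ≤ (x : ℕ) → m ≤ (v x : ℕ)) →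
      (∀ x y : Fin (n + 1), m ≤ (x : ℕ) → x < y → v x < v y) →
      ∀ x : Fin (n + 1), m ≤ (x : ℕ) → x ≤ v x := by
    intro v h1 h2 x
    induction x using Fin.induction with
    | zero => intro _; exact Fin.zero_le _
    | succ i ih =>
      intro h
      rcases h.eq_or_lt with e | e
      · exact Fin.le_def.2 (e ▸ h1 _ h)
      · have h3 := ih (by simp at e ⊢; omega)
        have h4 := h2 i.castSucc i.succ (by simp at e ⊢; omega) (by simp)
        rw [Fin.le_def] at h3 ⊢
        rw [Fin.lt_def] at h4
        simp at h3 ⊢; omega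
  have hw' : ∀ x : Fin (n + 1), m ≤ (w x : ℕ) ↔ m ≤ (x : ℕ) := fun x => by have := hw x; omega
  have hwi : ∀ x : Fin (n + 1), m ≤ (x : ℕ) → m ≤ (w⁻¹ x : ℕ) := fun x h =>
    (hw' _).1 (by simpa using h)
  refine le_antisymm ?_ (ge w (fun x h => (hw' x).2 h) mono x hx)
  have := ge w⁻¹ hwi (fun a b ha hab => ?_) (w x) ((hw' x).2 hx)
  · simpa using this
  · by_contra! h
    rcases h.eq_or_lt with e | e
    · exact hab.ne (w⁻¹.injective e).symm
    · have := mono _ _ (hwi b (ha.trans (Fin.lt_def.1 hab).le)) e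
      simp at this
      exact absurd hab this.not_gt

/-- For `w` decreasing on `{x < m}`, and the identity elsewhere, any other permutation which is the
identity outside of `{x < m}` precedes `w`. -/
theorem lexKey_lt_of_decreasing {m : ℕ} {u w : Perm (Fin (n + 1))}
    (hu : ∀ x, (u x : ℕ) < m ↔ (x : ℕ) < m) (hw : ∀ x, (w x : ℕ) < m ↔ (x : ℕ) < m)
    (hfix : ∀ x : Fin (n + 1), m ≤ (x : ℕ) → u x = w x)
    (hdec : ∀ i : Fin n, (i : ℕ) + 1 < m → w i.succ < w i.castSucc) (hne : u ≠ w) :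
    lexKey u < lexKey w := by
  rcases lt_trichotomy (lexKey u) (lexKey w) with h | h | h
  · exact h
  · exact absurd (lexKey_injective h) hne
  obtain ⟨x, h1, h2⟩ := lexKey_lt_iff.1 h
  exfalso
  have hx : (x : ℕ) < m := by
    by_contra! hx
    exact h2.ne (hfix x hx).symm
  have hy : (w⁻¹ (u x) : ℕ) < m := by
    rw [← hw]; simpa using (hu x).2 hx
  have hy2 : w (w⁻¹ (u x)) = u x := by simp
  rcases lt_trichotomy (w⁻¹ (u x)) x with h | h | h
  · have := h1 _ h
    rw [hy2] at this
    exact h.ne (u.injective this).symm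
  · rw [h] at hy2; exact h2.ne hy2
  · have := gt_of_steps (w := w) h fun i _ hi => hdec i (by omega)
    rw [hy2] at this
    exact absurd h2 this.not_gt

/-- The reversal of `{0, …, m - 1}` is the last of the permutations occurring in the alternating sum:
if `F` vanishes before it, its term is the only one left. -/
theorem eq_zero_of_altPairing {m : ℕ} {F : Finset (Fin (n + 2)) → Perm (Fin (n + 1)) → k}
    (h0 : altPairing m F = 0) {w : Perm (Fin (n + 1))}
    (hw : ∀ u, lexKey u < lexKey w → ∀ t, F t u = 0)
    (hpres : ∀ x, (w x : ℕ) < m ↔ (x : ℕ) < m)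
    (hinc : ∀ i : Fin n, m ≤ (i : ℕ) → w i.castSucc < w i.succ)
    (hdec : ∀ i : Fin n, (i : ℕ) + 1 < m → w i.succ < w i.castSucc) :
    F (firstCuts n m) w = 0 := by
  have hfix : ∀ x : Fin (n + 1), m ≤ (x : ℕ) → w x = x := fun x hx =>
    apply_eq_self_of_increasing hpres hinc hx
  let w₀ : Perm {x : Fin (n + 1) // (x : ℕ) < m} := w.subtypePerm hpres
  have hw0 : Perm.ofSubtype w₀ = w :=
    Perm.ofSubtype_subtypePerm hpres fun x hx => by
      by_contra h
      exact hx (hfix x (not_lt.1 h))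
  rw [altPairing, sum_eq_single_of_mem w₀ (mem_univ _)] at h0
  · rw [hw0] at h0
    refine (mul_eq_zero.1 h0).resolve_left ?_
    rcases Int.units_eq_one_or (Perm.sign w₀) with h | h <;> simp [h]
  · intro u _ hu
    rw [hw _ (lexKey_lt_of_decreasing (m := m) ?_ hpres ?_ hdec ?_), mul_zero]
    · intro x
      by_cases hx : (x : ℕ) < m
      · exact iff_of_true (ofSubtype_val_lt u hx) hx
      · rw [Perm.ofSubtype_apply_of_not_mem u hx]
    · intro x hx
      rw [hfix x hx, Perm.ofSubtype_apply_of_not_mem u (not_lt.2 hx)]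
    · intro h
      exact hu (Perm.ofSubtype_injective (h.trans hw0.symm))

end Pairing

/-! ### Acyclicity of flag cochains -/

section Exactness

variable {n : ℕ} {k : Type*} [Field k]

/-- For a cochain vanishing before `w` there is a cut which can be toggled at `w`. The only set of
cuts for which the toggling would leave the complex is `firstCuts n m`, for `w` the reversal of
`{0, …, m - 1}`, and the value there is controlled by `altPairing`. -/
theorem IsFlagCochain.exists_toggle {m q : ℕ} (hm : 2 ≤ m) (hmn : m ≤ n + 1)
    {F : Finset (Fin (n + 2)) → Perm (Fin (n + 1)) → k} (hF : IsFlagCochain m q F)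
    (h0 : altPairing m F = 0) {w : Perm (Fin (n + 1))}
    (hw : ∀ u, lexKey u < lexKey w → ∀ t, F t u = 0) :
    ∃ v : Fin (n + 2), (∀ i : Fin n, w i.succ < w i.castSucc → cutAt i ≠ v) ∧
      ∀ t, v ∉ t → F (insert v t) w ≠ 0 →
        ∀ i : Fin (n + 1), (i : ℕ) < m → Encloses t (w⁻¹ i) := by
  let S : Finset (Fin (n + 1)) := {x | (w x : ℕ) < m}
  have hS : S.Nonempty := ⟨w⁻¹ 0, by simp [S]; omega⟩
  -- the first and the last position of a value less than `m`
  let l := S.min' hS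
  let e := S.max' hS
  have hl : (w l : ℕ) < m := (mem_filter.1 (S.min'_mem hS)).2
  have he : (w e : ℕ) < m := (mem_filter.1 (S.max'_mem hS)).2
  have hle : ∀ x, (w x : ℕ) < m → l ≤ x := fun x hx => S.min'_le x (by simpa [S] using hx)
  have hge : ∀ x, (w x : ℕ) < m → x ≤ e := fun x hx => S.le_max' x (by simpa [S] using hx)
  have henc : ∀ t, F t w ≠ 0 → (∃ c ∈ t, (c : ℕ) ≤ l) ∧ ∃ c ∈ t, (e : ℕ) < c := fun t ht =>
    ⟨by simpa using (hF.encl t w ht (w l) hl).1, by simpa using (hF.encl t w ht (w e) he).2⟩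
  have suff : ∀ t : Finset (Fin (n + 2)), (∃ c ∈ t, (c : ℕ) ≤ l) → (∃ c ∈ t, (e : ℕ) < c) →
      ∀ i : Fin (n + 1), (i : ℕ) < m → Encloses t (w⁻¹ i) := by
    rintro t ⟨c, hc, hc'⟩ ⟨d, hd, hd'⟩ i hi
    have h1 := Fin.le_def.1 (hle (w⁻¹ i) (by simpa using hi))
    have h2 := Fin.le_def.1 (hge (w⁻¹ i) (by simpa using hi))
    exact ⟨⟨c, hc, hc'.trans h1⟩, d, hd, h2.trans_lt hd'⟩
  -- with a descent before `l`, the cut `0` is not needed to enclose `l`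
  by_cases c1 : ∃ i : Fin n, w i.succ < w i.castSucc ∧ (i : ℕ) < l
  · obtain ⟨i, hi, hil⟩ := c1
    refine ⟨0, fun j _ h => by simpa using congrArg Fin.val h, fun t _ ht => suff t ?_ ?_⟩
    · refine ⟨cutAt i, (mem_insert.1 (hF.cutAt_mem hw ht hi)).resolve_left fun h => ?_, ?_⟩
      · simpa using congrArg Fin.val h
      · rw [val_cutAt]; exact hil
    · obtain ⟨c, hc, hc'⟩ := (henc _ ht).2
      refine ⟨c, (mem_insert.1 hc).resolve_left ?_, hc'⟩
      rintro rfl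
      simp at hc'
  -- with a descent after `e`, the cut `n + 1` is not needed to enclose `e`
  by_cases c2 : ∃ i : Fin n, w i.succ < w i.castSucc ∧ (e : ℕ) ≤ i
  · obtain ⟨i, hi, hil⟩ := c2
    refine ⟨Fin.last (n + 1), fun j _ h => ?_, fun t _ ht => suff t ?_ ?_⟩
    · have := congrArg Fin.val h
      simp at this; omega
    · obtain ⟨c, hc, hc'⟩ := (henc _ ht).1
      refine ⟨c, (mem_insert.1 hc).resolve_left ?_, hc'⟩
      rintro rfl
      simp at hc'; omega
    · refine ⟨cutAt i, (mem_insert.1 (hF.cutAt_mem hw ht hi)).resolve_left fun h => ?_, ?_⟩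
      · have := congrArg Fin.val h
        simp at this; omega
      · rw [val_cutAt]; omega
  -- a cut strictly inside does not matter for enclosing `l` and `e`
  by_cases c3 : ∃ i : Fin n, ¬ w i.succ < w i.castSucc ∧ (l : ℕ) ≤ i ∧ (i : ℕ) < e
  · obtain ⟨i, hi, hil, hie⟩ := c3
    refine ⟨cutAt i, fun j hj h => hi (cutAt_injective h ▸ hj), fun t _ ht => suff t ?_ ?_⟩
    · obtain ⟨c, hc, hc'⟩ := (henc _ ht).1
      refine ⟨c, (mem_insert.1 hc).resolve_left ?_, hc'⟩
      rintro rfl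
      simp at hc'; omega
    · obtain ⟨c, hc, hc'⟩ := (henc _ ht).2
      refine ⟨c, (mem_insert.1 hc).resolve_left ?_, hc'⟩
      rintro rfl
      simp at hc'; omega
  push Not at c1 c2 c3
  -- the positions of the values less than `m` form the decreasing run from `l` to `e`
  have hdec : ∀ i : Fin n, (l : ℕ) ≤ i → (i : ℕ) < e → w i.succ < w i.castSucc := fun i h h' => by
    by_contra hc
    exact absurd (c3 i (not_lt.1 hc) h) (not_le.2 h')
  have hbet : ∀ x, l ≤ x → x ≤ e → (w x : ℕ) < m := by
    intro x h1 h2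
    rcases h1.eq_or_lt with h | h
    · exact h ▸ hl
    · have := gt_of_steps (w := w) h fun i hi hi' =>
        hdec i hi (hi'.trans_le (Fin.le_def.1 h2))
      exact (Fin.lt_def.1 this).trans hl
  -- a value preceding this run would be larger, and produce another descent
  have hl0 : (l : ℕ) = 0 := by
    by_contra hne
    have hi : (l : ℕ) - 1 < n := by omega
    have e1 : (⟨l - 1, hi⟩ : Fin n).succ = l := Fin.ext (by simp; omega)
    have h1 : w (⟨l - 1, hi⟩ : Fin n).castSucc < w (⟨l - 1, hi⟩ : Fin n).succ :=
      castSucc_lt_of_not fun h => by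
        have : (l : ℕ) ≤ l - 1 := c1 ⟨l - 1, hi⟩ h
        omega
    rw [e1] at h1
    have : (l : ℕ) ≤ l - 1 := Fin.le_def.1 (hle _ ((Fin.lt_def.1 h1).trans hl))
    omega
  have hS' : ∀ x, (w x : ℕ) < m ↔ (x : ℕ) < e + 1 := fun x =>
    ⟨fun h => Nat.lt_succ_of_le (Fin.le_def.1 (hge x h)), fun h =>
      hbet x (Fin.le_def.2 (by omega)) (Fin.le_def.2 (by omega))⟩
  have hem : (e : ℕ) + 1 = m := by
    have h1 := card_filter_apply_lt hmn w
    simp only [hS'] at h1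
    rwa [card_filter_val_lt (by omega)] at h1
  rw [hem] at hS'
  have hzero : F (firstCuts n m) w = 0 := eq_zero_of_altPairing h0 hw hS'
    (fun i hi => castSucc_lt_of_not fun h => absurd (c2 i h) (by omega))
    fun i hi => hdec i (by omega) (by omega)
  refine ⟨e.succ, fun i hi h => ?_, fun t _ ht => suff t ?_ ?_⟩
  · have := congrArg Fin.val h
    simp at this
    exact absurd (c2 i hi) (by omega)
  · obtain ⟨c, hc, hc'⟩ := (henc _ ht).1
    refine ⟨c, (mem_insert.1 hc).resolve_left ?_, hc'⟩
    rintro rfl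
    simp at hc'; omega
  · by_contra! hno
    have : insert e.succ t = firstCuts n m := by
      ext c
      simp only [firstCuts, mem_filter, mem_univ, true_and]
      constructor
      · intro hc
        rcases mem_insert.1 hc with rfl | hc
        · simp; omega
        · have := hno c hc; omega
      · intro hc
        rcases Nat.eq_zero_or_pos (c : ℕ) with h | h
        · obtain ⟨d, hd, hd'⟩ := (henc _ ht).1
          rwa [show c = d from Fin.ext (by omega)]
        rcases hc.eq_or_lt with h' | h'
        · rw [show c = e.succ from Fin.ext (by simp; omega)]
          exact mem_insert_self _ _
        · have hc1 : (c : ℕ) - 1 < n := by omega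
          rw [show c = cutAt ⟨c - 1, hc1⟩ from Fin.ext (by simp; omega)]
          exact hF.cutAt_mem hw ht (hdec _ (by simp; omega) (by simp; omega))
    exact ht (this ▸ hzero)

open Classical in
/-- A flag cocycle is a coboundary as soon as its value at the fundamental cycle vanishes. -/
theorem IsFlagCochain.exists_eq_cobd [CharZero k] {m q : ℕ} (hm : 2 ≤ m) (hmn : m ≤ n + 1)
    {F : Finset (Fin (n + 2)) → Perm (Fin (n + 1)) → k} (hF : IsFlagCochain m (q + 1) F)
    (hd : ∀ t w, DynkinCohomology.cobd (fun t => F t w) t = 0) (h0 : altPairing m F = 0) :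
    ∃ G : Finset (Fin (n + 2)) → Perm (Fin (n + 1)) → k, IsFlagCochain m q G ∧
      ∀ t w, F t w = DynkinCohomology.cobd (fun t => G t w) t := by
  obtain ⟨N, hN⟩ : ∃ N, #{u | ∃ w, lexKey w ≤ lexKey u ∧ ∃ t, F t w ≠ 0} = N := ⟨_, rfl⟩
  induction N using Nat.strong_induction_on generalizing F with
  | _ N ih =>
  by_cases hz : ∀ w t, F t w = 0
  · exact ⟨fun _ _ => 0, ⟨fun _ _ h => absurd rfl h, fun _ _ h => absurd rfl h, fun _ _ _ _ => rfl⟩,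
      fun t w => by simp [hz, DynkinCohomology.cobd]⟩
  -- eliminate the value at the first permutation where `F` does not vanish
  obtain ⟨w, hwne, hw⟩ : ∃ w, (∃ t, F t w ≠ 0) ∧ ∀ u, lexKey u < lexKey w → ∀ t, F t u = 0 := by
    push Not at hz
    obtain ⟨w, hw, hmin⟩ := exists_min_image {w | ∃ t, F t w ≠ 0} lexKey
      (by obtain ⟨w, hw⟩ := hz; exact ⟨w, by simpa using hw⟩)
    refine ⟨w, by simpa using hw, fun u hu t => ?_⟩
    by_contra h
    exact absurd hu (not_lt.2 (hmin u (by simpa using ⟨t, h⟩)))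
  obtain ⟨v, hv, henc⟩ := hF.exists_toggle hm hmn h0 hw
  obtain ⟨G, hG, hFG⟩ := hF.exists_cobd_eq hd hw v hv henc
  have hlt : #{u | ∃ w', lexKey w' ≤ lexKey u ∧
      ∃ t, F t w' - DynkinCohomology.cobd (fun t => G t w') t ≠ 0} < N := by
    rw [← hN]
    refine card_lt_card ((ssubset_iff_of_subset ?_).2 ⟨w, ?_, ?_⟩)
    · intro u hu
      simp only [mem_filter, mem_univ, true_and] at hu ⊢
      obtain ⟨w', h1, t, h2⟩ := hu
      refine ⟨w, ?_, hwne⟩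
      by_contra! h3
      exact h2 (sub_eq_zero.2 (hFG w' (h1.trans h3.le) t))
    · simpa using ⟨w, le_rfl, hwne⟩
    · simp only [mem_filter, mem_univ, true_and, not_exists, not_and, not_not]
      intro w' h t
      exact sub_eq_zero.2 (hFG w' h t)
  obtain ⟨G', hG', hFG'⟩ := ih _ hlt (hF.sub hG.cobd)
    (fun t w => by
      rw [cobd_sub (fun t => F t w) (fun t => DynkinCohomology.cobd (fun t => G t w) t), hd,
        zero_sub, neg_eq_zero]
      exact cobd_cobd _ t)
    (by rw [altPairing_sub, h0, altPairing_cobd (by omega) hmn hG, sub_zero]) rfl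
  refine ⟨fun t w => G t w - -G' t w, hG.sub ⟨fun t w h => hG'.card t w (neg_ne_zero.1 h),
    fun t w h => hG'.encl t w (neg_ne_zero.1 h), fun t w i hi => by rw [hG'.inv t w i hi]⟩,
    fun t w => ?_⟩
  have h1 := hFG' t w
  have h2 : DynkinCohomology.cobd (fun t => -G' t w) t =
      -DynkinCohomology.cobd (fun t => G' t w) t := by
    simp [DynkinCohomology.cobd]
  rw [cobd_sub (fun t => G t w), h2, ← h1]
  ring

end Exactness

/-! ### Class cochains -/

section ClassCochains

variable {n : ℕ} {k : Type*} [Field k]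

/-- The Dynkin cochains with values in the span of `c`, in terms of sets of cuts: a pair `(B, α)`
with `|α| = q - 2` corresponds to the set `t` of `q` cuts whose extremal elements delimit the
interval of points moved by the reflections of `B`, and whose interior elements are those of `α`.
The condition `two_le` expresses that `B` is not empty. -/
structure IsClassCochain (c : Set (Perm (Fin (n + 1)))) (q : ℕ)
    (b : Finset (Fin (n + 2)) → Perm (Fin (n + 1)) → k) : Prop where
  card : ∀ t h, b t h ≠ 0 → t.card = q
  mem : ∀ t h, b t h ≠ 0 → h ∈ c
  encl : ∀ t h, b t h ≠ 0 → ∀ x, h x ≠ x → Encloses t x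
  two_le : ∀ t h, b t h ≠ 0 → ∃ x ∈ t, ∃ y ∈ t, (x : ℕ) + 2 ≤ y
  inv : ∀ t h (i : Fin n), cutAt i ∉ t → b t (simpleA n i * h * simpleA n i) = b t h

theorem IsClassCochain.eq_zero_of_card_one {c : Set (Perm (Fin (n + 1)))}
    {b : Finset (Fin (n + 2)) → Perm (Fin (n + 1)) → k} (hb : IsClassCochain c 1 b) (t h) :
    b t h = 0 := by
  by_contra hne
  obtain ⟨x, hx, y, hy, hxy⟩ := hb.two_le t h hne
  have := card_le_one.1 (hb.card t h hne).le x hx y hy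
  subst this
  omega

theorem mul_simpleA_conj {g h w : Perm (Fin (n + 1))} {i : Fin n} :
    (w * simpleA n i)⁻¹ * g * (w * simpleA n i) = h ↔
      w⁻¹ * g * w = simpleA n i * h * simpleA n i := by
  rw [mul_inv_rev, simpleA_inv]
  constructor
  · rintro rfl
    simp only [← mul_assoc, simpleA_mul_self, one_mul]
    simp only [mul_assoc, simpleA_mul_self, mul_one]
  · intro e
    calc simpleA n i * w⁻¹ * g * (w * simpleA n i)
        = simpleA n i * (w⁻¹ * g * w) * simpleA n i := by simp only [mul_assoc]
      _ = h := by
        rw [e]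
        simp only [← mul_assoc, simpleA_mul_self, one_mul]
        simp only [mul_assoc, simpleA_mul_self, mul_one]

/-- Restriction of a class cochain to the conjugates `w⁻¹ g w` of `g`. -/
theorem IsClassCochain.pullback {c : Set (Perm (Fin (n + 1)))} {m q : ℕ}
    {b : Finset (Fin (n + 2)) → Perm (Fin (n + 1)) → k} (hb : IsClassCochain c q b)
    {g : Perm (Fin (n + 1))} (hg : ∀ x, g x ≠ x ↔ (x : ℕ) < m) :
    IsFlagCochain m q (fun t w => b t (w⁻¹ * g * w)) where
  card t w h := hb.card t _ h
  encl t w h i hi := hb.encl t _ h _ (by simpa using (hg i).2 hi)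
  inv t w i hi := by
    rw [← hb.inv t (w⁻¹ * g * w) i hi, mul_simpleA_conj.2 ?_]
    simp only [← mul_assoc, simpleA_mul_self, one_mul]
    simp only [mul_assoc, simpleA_mul_self, mul_one]

theorem sum_conj_eq_simpleA (g h : Perm (Fin (n + 1))) (i : Fin n) (f : Perm (Fin (n + 1)) → k) :
    ∑ w with w⁻¹ * g * w = simpleA n i * h * simpleA n i, f w =
      ∑ w with w⁻¹ * g * w = h, f (w * simpleA n i) := by
  refine sum_bij' (fun w _ => w * simpleA n i) (fun w _ => w * simpleA n i) ?_ ?_ ?_ ?_ ?_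
  · intro w hw
    simp only [mem_filter, mem_univ, true_and] at hw ⊢
    exact mul_simpleA_conj.2 hw
  · intro w hw
    simp only [mem_filter, mem_univ, true_and] at hw ⊢
    rw [mul_simpleA_conj, hw]
    simp only [← mul_assoc, simpleA_mul_self, one_mul]
    simp only [mul_assoc, simpleA_mul_self, mul_one]
  · intro w _
    rw [mul_assoc, simpleA_mul_self, mul_one]
  · intro w _
    rw [mul_assoc, simpleA_mul_self, mul_one]
  · intro w _
    rw [mul_assoc, simpleA_mul_self, mul_one]

/-- Summation over the `w` conjugating `g` to a given element turns flag cochains into class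
cochains. -/
theorem IsFlagCochain.pushforward {m q : ℕ} (hm : 2 ≤ m) (hmn : m ≤ n + 1)
    {G : Finset (Fin (n + 2)) → Perm (Fin (n + 1)) → k} (hG : IsFlagCochain m q G)
    {g : Perm (Fin (n + 1))} (hg : ∀ x, g x ≠ x ↔ (x : ℕ) < m) :
    IsClassCochain {h | IsConj g h} q (fun t h => ∑ w with w⁻¹ * g * w = h, G t w) := by
  have key : ∀ t h, ∑ w with w⁻¹ * g * w = h, G t w ≠ 0 → ∃ w, w⁻¹ * g * w = h ∧ G t w ≠ 0 := by
    intro t h hne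
    obtain ⟨w, hw, hw'⟩ := exists_ne_zero_of_sum_ne_zero hne
    exact ⟨w, by simpa using hw, hw'⟩
  refine ⟨fun t h hne => ?_, fun t h hne => ?_, fun t h hne x hx => ?_, fun t h hne => ?_,
    fun t h i hi => ?_⟩
  · obtain ⟨w, -, hw⟩ := key t h hne
    exact hG.card t w hw
  · obtain ⟨w, hw, -⟩ := key t h hne
    exact isConj_iff.2 ⟨w⁻¹, by simpa using hw⟩
  · obtain ⟨w, rfl, hw⟩ := key t h hne
    have := hG.encl t w hw (w x) ((hg _).1 fun e => hx (by simp [e]))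
    simpa using this
  · obtain ⟨w, -, hw⟩ := key t h hne
    have e0 := hG.encl t w hw ⟨0, by omega⟩ (by simp; omega)
    have e1 := hG.encl t w hw ⟨1, by omega⟩ (by simp; omega)
    have hne : (w⁻¹ ⟨0, by omega⟩ : ℕ) ≠ (w⁻¹ ⟨1, by omega⟩ : Fin (n + 1)) := fun e => by
      have := w⁻¹.injective (Fin.ext e)
      simp at this
    rcases lt_or_gt_of_ne hne with h | h
    · obtain ⟨x, hx, hx'⟩ := e0.1
      obtain ⟨y, hy, hy'⟩ := e1.2
      exact ⟨x, hx, y, hy, by omega⟩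
    · obtain ⟨x, hx, hx'⟩ := e1.1
      obtain ⟨y, hy, hy'⟩ := e0.2
      exact ⟨x, hx, y, hy, by omega⟩
  · rw [sum_conj_eq_simpleA]
    exact sum_congr rfl fun w _ => hG.inv t w i hi

/-- Class cocycles with vanishing value at the fundamental cycle are coboundaries: a primitive of
the restriction to the conjugates `w⁻¹ g w` is averaged over the `w` with the same conjugate. -/
theorem IsClassCochain.exists_eq_cobd [CharZero k] {m q : ℕ} (hm : 2 ≤ m) (hmn : m ≤ n + 1)
    {g : Perm (Fin (n + 1))} (hg : ∀ x, g x ≠ x ↔ (x : ℕ) < m)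
    {b : Finset (Fin (n + 2)) → Perm (Fin (n + 1)) → k}
    (hb : IsClassCochain {h | IsConj g h} (q + 1) b)
    (hd : ∀ t h, cobd (fun t => b t h) t = 0)
    (h0 : altPairing m (fun t w => b t (w⁻¹ * g * w)) = 0) :
    ∃ b' : Finset (Fin (n + 2)) → Perm (Fin (n + 1)) → k,
      IsClassCochain {h | IsConj g h} q b' ∧ ∀ t h, b t h = cobd (fun t => b' t h) t := by
  obtain ⟨G, hG, hFG⟩ := (hb.pullback hg).exists_eq_cobd hm hmn (fun t w => hd t _) h0
  have hP := hG.pushforward hm hmn hg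
  let N : Perm (Fin (n + 1)) → k := fun h => ∑ w with w⁻¹ * g * w = h, 1
  refine ⟨fun t h => (N h)⁻¹ * ∑ w with w⁻¹ * g * w = h, G t w,
    ⟨fun t h hne => hP.card t h (right_ne_zero_of_mul hne),
      fun t h hne => hP.mem t h (right_ne_zero_of_mul hne),
      fun t h hne => hP.encl t h (right_ne_zero_of_mul hne),
      fun t h hne => hP.two_le t h (right_ne_zero_of_mul hne), fun t h i hi => ?_⟩, fun t h => ?_⟩
  · rw [hP.inv t h i hi]
    simp only [N, sum_conj_eq_simpleA]
  · rw [cobd_const_mul, cobd_sum]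
    have e : ∑ w with w⁻¹ * g * w = h, cobd (fun t => G t w) t = N h * b t h := by
      simp only [N, sum_mul, one_mul]
      refine sum_congr rfl fun w hw => ?_
      rw [← hFG, (mem_filter.1 hw).2]
    rw [e]
    by_cases hc : IsConj g h
    · have hN : N h ≠ 0 := by
        obtain ⟨w, hw⟩ := isConj_iff.1 hc
        simp only [N, sum_const, nsmul_eq_mul, mul_one, Nat.cast_ne_zero]
        exact card_ne_zero.2 ⟨w⁻¹, by simpa using hw⟩
      rw [inv_mul_cancel_left₀ hN]
    · have : b t h = 0 := by
        by_contra hne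
        exact hc (hb.mem t h hne)
      rw [this, mul_zero, mul_zero]

/-- If an odd permutation of the moved points of `g` centralizes `g`, all class cochains vanish at
the fundamental cycle. -/
theorem altPairing_eq_zero_of_odd [CharZero k] {m : ℕ} {g : Perm (Fin (n + 1))}
    {z : Perm {x : Fin (n + 1) // (x : ℕ) < m}} (hz : Perm.sign z = -1)
    (hzg : Perm.ofSubtype z * g = g * Perm.ofSubtype z)
    (b : Finset (Fin (n + 2)) → Perm (Fin (n + 1)) → k) :
    altPairing m (fun t w => b t (w⁻¹ * g * w)) = 0 := by
  rw [← CharZero.eq_neg_self_iff (R := k)]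
  conv_lhs => rw [altPairing, ← Equiv.sum_comp (Equiv.mulLeft z)]
  rw [altPairing, ← sum_neg_distrib]
  refine sum_congr rfl fun u _ => ?_
  have e : (Perm.ofSubtype (z * u))⁻¹ * g * Perm.ofSubtype (z * u) =
      (Perm.ofSubtype u)⁻¹ * g * Perm.ofSubtype u := by
    rw [map_mul, mul_inv_rev, mul_assoc, mul_assoc, mul_assoc, ← mul_assoc g, ← hzg, mul_assoc,
      inv_mul_cancel_left]
  rw [Equiv.coe_mulLeft, map_mul, hz, e]
  simp

end ClassCochains

/-! ### The class of the identity -/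

section Identity

variable {n : ℕ} {k : Type*} [Field k]

theorem exists_add_two_le_of_two_lt_card {t : Finset (Fin (n + 2))} (ht : 2 < t.card) :
    ∃ x ∈ t, ∃ y ∈ t, (x : ℕ) + 2 ≤ y := by
  obtain ⟨a, b, c, ha, hb, hc, hab, hac, hbc⟩ := two_lt_card_iff.1 ht
  by_contra! h
  have h1 := h a ha b hb
  have h2 := h b hb a ha
  have h3 := h a ha c hc
  have h4 := h c hc a ha
  have h5 := h b hb c hc
  have h6 := h c hc b hb
  rw [ne_eq, Fin.ext_iff] at hab hac hbc
  omega

theorem eq_pair_of_not_add_two_le {t : Finset (Fin (n + 2))} (ht : t.card = 2)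
    (h : ¬ ∃ x ∈ t, ∃ y ∈ t, (x : ℕ) + 2 ≤ y) :
    ∃ j : Fin (n + 1), t = {j.castSucc, j.succ} := by
  obtain ⟨a, b, hab, rfl⟩ := card_eq_two.1 ht
  wlog hlt : a < b generalizing a b
  · rw [pair_comm a b] at ht h ⊢
    exact this b a hab.symm ht h (lt_of_le_of_ne (not_lt.1 hlt) hab.symm)
  push Not at h
  have h1 := h a (by simp) b (by simp)
  rw [Fin.lt_def] at hlt
  refine ⟨⟨a, by omega⟩, ?_⟩
  rw [show (⟨a, by omega⟩ : Fin (n + 1)).castSucc = a from rfl,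
    show (⟨a, by omega⟩ : Fin (n + 1)).succ = b from Fin.ext (by simp; omega)]

theorem cobd_pair {ι R : Type*} [LinearOrder ι] [CommRing R] (f : Finset ι → R) {a b : ι}
    (h : a < b) : cobd f {a, b} = f {b} - f {a} := by
  have e1 : ({y ∈ ({a, b} : Finset ι) | y < a} : Finset ι) = ∅ := by
    ext y
    simp only [mem_filter, mem_insert, mem_singleton, notMem_empty, iff_false]
    rintro ⟨rfl | rfl, h'⟩
    · exact lt_irrefl _ h'
    · exact h.not_gt h'
  have e2 : ({y ∈ ({a, b} : Finset ι) | y < b} : Finset ι) = {a} := by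
    ext y
    simp only [mem_filter, mem_insert, mem_singleton]
    constructor
    · rintro ⟨rfl | rfl, h'⟩
      · rfl
      · exact absurd h' (lt_irrefl _)
    · rintro rfl; exact ⟨Or.inl rfl, h⟩
  have e3 : ({a, b} : Finset ι).erase b = {a} := by
    rw [pair_comm, erase_insert (by simpa using h.ne')]
  rw [cobd, sum_pair h.ne, e1, e2, e3, erase_insert (by simpa using h.ne)]
  simp
  ring

/-- A simplicial cocycle vanishing at the edges `{j, j + 1}` has a primitive vanishing there. -/
theorem exists_cobd_eq_of_path {q : ℕ} (hq : 1 ≤ q) {f : Finset (Fin (n + 2)) → k}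
    (hcard : ∀ t, f t ≠ 0 → t.card = q + 1)
    (htwo : ∀ t, f t ≠ 0 → ∃ x ∈ t, ∃ y ∈ t, (x : ℕ) + 2 ≤ y) (hd : ∀ t, cobd f t = 0) :
    ∃ f' : Finset (Fin (n + 2)) → k, (∀ t, f' t ≠ 0 → t.card = q) ∧
      (∀ t, f' t ≠ 0 → ∃ x ∈ t, ∃ y ∈ t, (x : ℕ) + 2 ≤ y) ∧ ∀ t, f t = cobd f' t := by
  have hcone : ∀ t, cone 0 f t ≠ 0 → t.card = q := by
    intro t h
    rw [cone] at h
    split_ifs at h with h0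
    · exact absurd rfl h
    · have := hcard _ (right_ne_zero_of_mul h)
      rw [card_insert_of_notMem h0] at this
      omega
  have hprim : ∀ t, f t = cobd (cone 0 f) t := by
    intro t
    have h1 := cobd_cone_add 0 f t
    rw [show cobd f = 0 from funext hd] at h1
    rw [← h1]
    simp [cone]
  have hpath : ∀ j : Fin (n + 1), f {j.castSucc, j.succ} = 0 := by
    intro j
    by_contra h
    obtain ⟨x, hx, y, hy, hxy⟩ := htwo _ h
    simp only [mem_insert, mem_singleton] at hx hy
    rcases hx with rfl | rfl <;> rcases hy with rfl | rfl <;> simp at hxy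
    omega
  rcases (by omega : q = 1 ∨ q = 2 ∨ 3 ≤ q) with rfl | rfl | hq3
  · -- the cone is a function on vertices which is constant along the path, and zero at its start
    have hv : ∀ c : Fin (n + 2), cone 0 f {c} = 0 := by
      intro c
      induction c using Fin.induction with
      | zero => simp [cone]
      | succ j ih =>
        have h1 := hprim {j.castSucc, j.succ}
        rw [hpath, cobd_pair _ (Fin.castSucc_lt_succ), ih, sub_zero] at h1
        exact h1.symm
    have hz : ∀ t, cone 0 f t = 0 := by
      intro t
      by_contra h
      obtain ⟨c, rfl⟩ := card_eq_one.1 (hcone t h)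
      exact h (hv c)
    exact ⟨cone 0 f, hcone, fun t h => absurd (hz t) h, hprim⟩
  · -- the values of the cone at the edges of the path are corrected by a function on vertices
    let S : Fin (n + 2) → k := fun c =>
      ∑ j : Fin (n + 1) with j.castSucc < c, cone 0 f {j.castSucc, j.succ}
    let e : Finset (Fin (n + 2)) → k := fun t => if t.card = 1 then ∑ c ∈ t, S c else 0
    have he : ∀ c, e {c} = S c := fun c => by simp [e]
    have hS : ∀ j : Fin (n + 1), S j.succ - S j.castSucc = cone 0 f {j.castSucc, j.succ} := by
      intro j
      have : ({i : Fin (n + 1) | i.castSucc < j.succ} : Finset _) =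
          insert j ({i : Fin (n + 1) | i.castSucc < j.castSucc} : Finset _) := by
        ext i
        simp only [mem_filter, mem_univ, true_and, mem_insert, Fin.lt_def, Fin.ext_iff]
        simp; omega
      simp only [S, this]
      rw [sum_insert (by simp), add_sub_cancel_right]
    have hcard' : ∀ t, cone 0 f t - cobd e t ≠ 0 → t.card = 2 := by
      intro t h
      by_cases h1 : cone 0 f t = 0
      · rw [h1, zero_sub, neg_ne_zero] at h
        obtain ⟨x, hx, hne⟩ := exists_ne_zero_of_sum_ne_zero h
        rw [← card_erase_add_one hx]
        have := right_ne_zero_of_mul hne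
        simp only [e, ne_eq, ite_eq_right_iff, Classical.not_imp] at this
        rw [this.1]
      · exact hcone t h1
    refine ⟨fun t => cone 0 f t - cobd e t, hcard', fun t h => ?_, fun t => ?_⟩
    · by_contra hno
      obtain ⟨j, rfl⟩ := eq_pair_of_not_add_two_le (hcard' t h) hno
      refine h (sub_eq_zero.2 ?_)
      rw [cobd_pair _ (Fin.castSucc_lt_succ), he, he, hS]
    · rw [cobd_sub, ← hprim]
      exact (sub_eq_self.2 (cobd_cobd e t)).symm
  · exact ⟨cone 0 f, hcone,
      fun t h => exists_add_two_le_of_two_lt_card (by rw [hcone t h]; omega), hprim⟩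

open Classical in
theorem IsClassCochain.exists_eq_cobd_one {q : ℕ} (hq : 1 ≤ q)
    {b : Finset (Fin (n + 2)) → Perm (Fin (n + 1)) → k} (hb : IsClassCochain {1} (q + 1) b)
    (hd : ∀ t h, cobd (fun t => b t h) t = 0) :
    ∃ b' : Finset (Fin (n + 2)) → Perm (Fin (n + 1)) → k,
      IsClassCochain {1} q b' ∧ ∀ t h, b t h = cobd (fun t => b' t h) t := by
  obtain ⟨f', h1, h2, h3⟩ := exists_cobd_eq_of_path hq (fun t => hb.card t 1)
    (fun t => hb.two_le t 1) fun t => hd t 1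
  refine ⟨fun t h => if h = 1 then f' t else 0, ⟨fun t h hne => ?_, fun t h hne => ?_,
    fun t h hne x hx => ?_, fun t h hne => ?_, fun t h i _ => ?_⟩, fun t h => ?_⟩
  · exact h1 t fun e => hne (by simp [e])
  · by_contra e
    exact hne (if_neg e)
  · by_cases e : h = 1
    · exact absurd (by simp [e]) hx
    · exact absurd (if_neg e) hne
  · exact h2 t fun e => hne (by simp [e])
  · have : simpleA n i * h * simpleA n i = 1 ↔ h = 1 := by
      constructor
      · intro e
        have := eq_inv_of_mul_eq_one_left e
        rw [simpleA_inv] at this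
        simpa using this
      · rintro rfl
        rw [mul_one, simpleA_mul_self]
    simp only [this]
  · by_cases e : h = 1
    · simpa [e] using h3 t
    · have : b t h = 0 := by
        by_contra hne
        exact e (hb.mem t h hne)
      simp [e, this, cobd]

end Identity

/-! ### Determinants -/

section Determinant

variable {k : Type*} [Field k]

theorem det_vecCons_perm {m : ℕ} (r : Fin (m + 1) → k) (v : Fin m → Fin (m + 1) → k)
    (σ : Perm (Fin m)) :
    (Matrix.of (Matrix.vecCons r (v ∘ σ))).det =
      ((Perm.sign σ : ℤ) : k) * (Matrix.of (Matrix.vecCons r v)).det := by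
  have h := ((Matrix.detRowAlternating (n := Fin (m + 1)) (R := k)).curryLeft r).map_perm v σ
  simp only [AlternatingMap.curryLeft_apply_apply] at h
  refine h.trans ?_
  rw [Units.smul_def, zsmul_eq_mul]
  rfl

variable {ι : Type*} [LinearOrder ι]

/-- For functions `v₁, …, vₘ` on `ι`, the simplicial cochain
`t ↦ det (1, v₁, …, vₘ)(t₀, …, tₘ)`. -/
def consDet {m : ℕ} (v : Fin m → ι → k) (t : Finset ι) : k :=
  if h : t.card = m + 1 then
    (Matrix.of (Matrix.vecCons 1 fun i j => v i (t.orderEmbOfFin h j))).det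
  else 0

theorem consDet_perm {m : ℕ} (v : Fin m → ι → k) (σ : Perm (Fin m)) (t : Finset ι) :
    consDet (v ∘ σ) t = ((Perm.sign σ : ℤ) : k) * consDet v t := by
  unfold consDet
  split_ifs with h
  · rw [← det_vecCons_perm]; rfl
  · rw [mul_zero]

/-- The cochain `consDet v` is closed: its coboundary is the expansion of a determinant with two
equal rows. -/
theorem cobd_consDet {m : ℕ} (v : Fin m → ι → k) (t : Finset ι) : cobd (consDet v) t = 0 := by
  by_cases h : t.card = m + 2
  · let e := t.orderEmbOfFin h
    let M : Matrix (Fin (m + 2)) (Fin (m + 2)) k :=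
      Matrix.of (Matrix.vecCons 1 (Matrix.vecCons 1 fun i j => v i (e j)))
    have hM : M.det = 0 := Matrix.det_zero_of_row_eq (i := 0) (j := 1) (by simp) rfl
    rw [Matrix.det_succ_row_zero] at hM
    rw [← hM, cobd]
    conv_lhs => rw [← map_orderEmbOfFin_univ t h, sum_map]
    refine sum_congr rfl fun j _ => ?_
    have h1 : #{y ∈ univ.map e.toEmbedding | y < e j} = (j : ℕ) := by
      rw [filter_map, card_map]
      simp [filter_gt_eq_Iio]
    have hmem : e j ∈ t := t.orderEmbOfFin_mem h j
    have h2 : (t.erase (e j)).card = m + 1 := by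
      have := card_erase_add_one hmem
      omega
    have h3 : ⇑(e) ∘ j.succAbove = (t.erase (e j)).orderEmbOfFin h2 :=
      orderEmbOfFin_unique h2 (fun i => mem_erase.2
        ⟨fun he => Fin.succAbove_ne j i (e.injective he), t.orderEmbOfFin_mem h _⟩)
        (e.strictMono.comp (Fin.strictMono_succAbove j))
    have h4 : M 0 j = 1 := rfl
    rw [h4, mul_one]
    refine congrArg₂ (fun a b => (-1 : k) ^ a * b) ?_ ?_
    · rw [map_orderEmbOfFin_univ] at h1 ⊢
      exact h1
    · have h5 : consDet v (t.erase (e j)) = (Matrix.of (Matrix.vecCons 1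
          fun i l => v i ((t.erase (e j)).orderEmbOfFin h2 l))).det := dif_pos h2
      rw [map_orderEmbOfFin_univ]
      refine h5.trans (congrArg Matrix.det ?_)
      ext i l
      refine Fin.cases ?_ (fun i => ?_) i
      · rfl
      · simp [M, ← h3]
  · refine sum_eq_zero fun x hx => ?_
    rw [consDet, dif_neg, mul_zero]
    have := card_erase_add_one hx
    omega

end Determinant

/-! ### The determinantal cocycle -/

section FlagDet

variable {n : ℕ} {k : Type*} [Field k]

/-- The flag cochain `det (1, v₁, …, vₘ)`, where `vᵢ` is the indicator function of the cuts above
the position of `i` in `w`. For `t = firstCuts n m`, it is the sign of `w` on the permutations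
of `{0, …, m - 1}`. -/
def flagDet (k : Type*) [Field k] {n m : ℕ} (hmn : m ≤ n + 1) (t : Finset (Fin (n + 2)))
    (w : Perm (Fin (n + 1))) : k :=
  consDet (fun (i : Fin m) (c : Fin (n + 2)) =>
    if (w⁻¹ (Fin.castLE hmn i) : ℕ) < c then (1 : k) else 0) t

theorem isFlagCochain_flagDet {m : ℕ} (hmn : m ≤ n + 1) :
    IsFlagCochain m (m + 1) (flagDet k hmn : Finset (Fin (n + 2)) → _) where
  card t w h := by
    by_contra hc
    exact h (dif_neg hc)
  encl t w hne x hx := by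
    by_contra hno
    apply hne
    unfold flagDet consDet
    split_ifs with h
    · have hxi : Fin.castLE hmn ⟨x, hx⟩ = x := rfl
      by_cases h1 : ∃ c ∈ t, (w⁻¹ x : ℕ) < c
      · -- all cuts are above the position of `x`: its row agrees with the first one
        have h2 : ∀ c ∈ t, (w⁻¹ x : ℕ) < c := fun c hc => by
          by_contra h'
          exact hno ⟨⟨c, hc, not_lt.1 h'⟩, h1⟩
        refine Matrix.det_zero_of_row_eq (i := 0) (j := (⟨x, hx⟩ : Fin m).succ)
          (Fin.succ_ne_zero _).symm ?_
        funext j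
        simpa [hxi] using h2 _ (t.orderEmbOfFin_mem h j)
      · refine Matrix.det_eq_zero_of_row_eq_zero (⟨x, hx⟩ : Fin m).succ fun j => ?_
        have : ¬ (w⁻¹ x : ℕ) < t.orderEmbOfFin h j := fun h' =>
          h1 ⟨_, t.orderEmbOfFin_mem h j, h'⟩
        simpa [hxi] using this
    · rfl
  inv t w i hi := by
    unfold flagDet consDet
    split_ifs with h
    · refine congrArg (fun v => (Matrix.of (Matrix.vecCons 1 v)).det) ?_
      funext a j
      have : ((t.orderEmbOfFin h j : Fin (n + 2)) : ℕ) ≠ i + 1 := fun e => hi (by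
        rw [show cutAt i = t.orderEmbOfFin h j from Fin.ext (by simp [e])]
        exact t.orderEmbOfFin_mem h j)
      simp only [mul_inv_rev, simpleA_inv, Perm.mul_apply, val_simpleA_lt_iff i _ this]
    · rfl

/-- The points `0, …, m - 1`, as an initial segment of `{0, …, n}`. -/
def finEquivLt {m : ℕ} (hmn : m ≤ n + 1) : Fin m ≃ {x : Fin (n + 1) // (x : ℕ) < m} where
  toFun i := ⟨Fin.castLE hmn i, i.2⟩
  invFun x := ⟨x.1, x.2⟩
  left_inv _ := rfl
  right_inv _ := rfl

theorem flagDet_mul {m : ℕ} (hmn : m ≤ n + 1) (t : Finset (Fin (n + 2)))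
    {z : Perm (Fin (n + 1))} {z₀ : Perm {x : Fin (n + 1) // (x : ℕ) < m}}
    (hz : ∀ x, z x.1 = (z₀ x).1) (w : Perm (Fin (n + 1))) :
    flagDet k hmn t (z * w) = ((Perm.sign z₀ : ℤ) : k) * flagDet k hmn t w := by
  let σ : Perm (Fin m) := (finEquivLt hmn).symm.permCongr z₀⁻¹
  have hσ : Perm.sign σ = Perm.sign z₀ := by
    rw [Perm.sign_permCongr, Perm.sign_inv]
  rw [← hσ, flagDet, flagDet, ← consDet_perm]
  refine congrArg (fun v => consDet v t) ?_
  funext i c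
  have h1 : z⁻¹ (Fin.castLE hmn i) = Fin.castLE hmn (σ i) := by
    rw [Perm.inv_eq_iff_eq]
    have : Fin.castLE hmn (σ i) = (z₀⁻¹ (finEquivLt hmn i)).1 := rfl
    rw [this, hz]
    simp [finEquivLt]
  simp only [mul_inv_rev, Perm.mul_apply, h1, Function.comp_apply]

theorem card_firstCuts {m : ℕ} (hmn : m ≤ n + 1) : (firstCuts n m).card = m + 1 := by
  rw [firstCuts]
  simp only [← Nat.lt_succ_iff]
  rw [Fin.card_filter_val_lt]
  omega

theorem flagDet_firstCuts_one {m : ℕ} (hmn : m ≤ n + 1) : flagDet k hmn (firstCuts n m) 1 = 1 := by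
  have hc := card_firstCuts hmn
  have he : (fun j : Fin (m + 1) => (⟨j, by omega⟩ : Fin (n + 2))) =
      (firstCuts n m).orderEmbOfFin hc :=
    orderEmbOfFin_unique hc (fun j => by simp [firstCuts]; omega) fun i j h => h
  rw [flagDet, consDet, dif_pos hc, ← he, Matrix.det_of_isUpperTriangular]
  · refine prod_eq_one fun i _ => Fin.cases ?_ (fun i => ?_) i <;> simp
  · intro i j
    refine Fin.cases ?_ (fun i => ?_) i
    · intro h; exact absurd h (Fin.not_lt_zero _)
    · intro h
      have h' : (j : ℕ) < i + 1 := h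
      simp
      omega

/-- If all permutations centralizing `g` are even on its moved points, there is a class cocycle
with non-zero value at the fundamental cycle. -/
theorem exists_cocycle_altPairing_ne_zero [CharZero k] {m : ℕ} (hm : 2 ≤ m) (hmn : m ≤ n + 1)
    {g : Perm (Fin (n + 1))} (hg : ∀ x, g x ≠ x ↔ (x : ℕ) < m)
    (heven : ∀ (z : Perm (Fin (n + 1))) (hz : ∀ x, (z x : ℕ) < m ↔ (x : ℕ) < m), z * g = g * z →
      Perm.sign (z.subtypePerm hz : Perm {x : Fin (n + 1) // (x : ℕ) < m}) = 1) :
    ∃ b : Finset (Fin (n + 2)) → Perm (Fin (n + 1)) → k,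
      IsClassCochain {h | IsConj g h} (m + 1) b ∧ (∀ t h, cobd (fun t => b t h) t = 0) ∧
      altPairing m (fun t w => b t (w⁻¹ * g * w)) ≠ 0 := by
  refine ⟨fun t h => ∑ w with w⁻¹ * g * w = h, flagDet k hmn t w,
    (isFlagCochain_flagDet hmn).pushforward hm hmn hg, fun t h => ?_, ?_⟩
  · rw [cobd_sum (f := fun w t => flagDet k hmn t w)]
    exact sum_eq_zero fun w _ => cobd_consDet _ t
  · have key : ∀ u : Perm {x : Fin (n + 1) // (x : ℕ) < m}, ∀ w : Perm (Fin (n + 1)),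
        w⁻¹ * g * w = (Perm.ofSubtype u)⁻¹ * g * Perm.ofSubtype u →
        flagDet k hmn (firstCuts n m) w = ((Perm.sign u : ℤ) : k) := by
      intro u w hw
      have hcomm : w * (Perm.ofSubtype u)⁻¹ * g = g * (w * (Perm.ofSubtype u)⁻¹) := by
        calc w * (Perm.ofSubtype u)⁻¹ * g
            = w * ((Perm.ofSubtype u)⁻¹ * g * Perm.ofSubtype u) * (Perm.ofSubtype u)⁻¹ := by group
          _ = g * (w * (Perm.ofSubtype u)⁻¹) := by rw [← hw]; group
      have hpres : ∀ x, ((w * (Perm.ofSubtype u)⁻¹) x : ℕ) < m ↔ (x : ℕ) < m := fun x => by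
        rw [← hg, ← hg, ← Perm.mul_apply, ← hcomm, Perm.mul_apply]
        exact (w * (Perm.ofSubtype u)⁻¹).injective.ne_iff
      have h1 := flagDet_mul (k := k) hmn (firstCuts n m)
        (z₀ := (w * (Perm.ofSubtype u)⁻¹).subtypePerm hpres) (fun x => rfl) (Perm.ofSubtype u)
      rw [heven _ hpres hcomm, inv_mul_cancel_right] at h1
      have h2 := flagDet_mul (k := k) hmn (firstCuts n m) (z := Perm.ofSubtype u) (z₀ := u)
        (fun x => Perm.ofSubtype_apply_coe u x) 1
      rw [flagDet_firstCuts_one, mul_one, mul_one] at h2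
      rw [h1, h2]
      simp
    have e : altPairing m (fun t w' => ∑ w with w⁻¹ * g * w = w'⁻¹ * g * w', flagDet k hmn t w) =
        ((∑ u : Perm {x : Fin (n + 1) // (x : ℕ) < m}, #{w | w⁻¹ * g * w =
          (Perm.ofSubtype u)⁻¹ * g * Perm.ofSubtype u} : ℕ) : k) := by
      rw [altPairing, Nat.cast_sum]
      refine sum_congr rfl fun u _ => ?_
      rw [sum_congr rfl fun w hw => key u w (mem_filter.1 hw).2, sum_const, nsmul_eq_mul,
        mul_left_comm, ← Int.cast_mul, ← Units.val_mul, Int.units_mul_self]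
      simp
    rw [e, Nat.cast_ne_zero]
    refine (sum_pos (fun u _ => card_pos.2 ⟨Perm.ofSubtype u, by simp⟩) ⟨1, mem_univ _⟩).ne'

end FlagDet

/-! ### Diagrams and parabolic subgroups -/

section Diagram

variable {n : ℕ}

theorem coxeterGraph_A_adj {i j : Fin n} :
    (coxeterGraph (CoxeterMatrix.A n)).Adj i j ↔ (i : ℕ) + 1 = j ∨ (j : ℕ) + 1 = i := by
  change (i ≠ j ∧ (if i = j then 1 else
    (if (j : ℕ) + 1 = i ∨ (i : ℕ) + 1 = j then 3 else 2)) ≠ 2) ↔ _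
  by_cases h : i = j
  · subst h; simp
  · rw [if_neg h]
    split_ifs with h' <;> simp [h] <;> omega

/-- The reflections exchanging adjacent points which both lie between the cuts `μ` and `ν`. -/
def interval (μ ν : Fin (n + 2)) : Finset (Fin n) := {i | (μ : ℕ) ≤ i ∧ (i : ℕ) + 1 < ν}

@[simp] theorem mem_interval {μ ν : Fin (n + 2)} {i : Fin n} :
    i ∈ interval μ ν ↔ (μ : ℕ) ≤ i ∧ (i : ℕ) + 1 < ν := by simp [interval]

theorem interval_nonempty {μ ν : Fin (n + 2)} : (interval μ ν).Nonempty ↔ (μ : ℕ) + 2 ≤ ν := by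
  constructor
  · rintro ⟨i, hi⟩
    rw [mem_interval] at hi
    omega
  · intro h
    exact ⟨⟨μ, by omega⟩, by rw [mem_interval]; simp; omega⟩

theorem isConnSub_iff_convex {B : Finset (Fin n)} :
    IsConnSub (coxeterGraph (CoxeterMatrix.A n)) B ↔
      B.Nonempty ∧ ∀ i ∈ B, ∀ j ∈ B, ∀ l, i ≤ l → l ≤ j → l ∈ B := by
  constructor
  · intro h
    refine ⟨?_, fun i hi j hj l hil hlj => ?_⟩
    · obtain ⟨x⟩ := h.nonempty
      exact ⟨x.1, x.2⟩
    · by_contra hl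
      obtain ⟨w⟩ := h.preconnected ⟨i, hi⟩ ⟨j, hj⟩
      -- a walk cannot cross the missing vertex `l`
      have key : ∀ {x y : (B : Set (Fin n))},
          ((coxeterGraph (CoxeterMatrix.A n)).induce (B : Set (Fin n))).Walk x y →
          x.1 < l → y.1 < l := by
        intro x y w
        induction w with
        | nil => exact id
        | cons hadj _ ih =>
          rename_i a b c _
          refine fun ha => ih ?_
          have h1 : (a.1 : ℕ) + 1 = b.1 ∨ (b.1 : ℕ) + 1 = a.1 :=
            coxeterGraph_A_adj.1 (SimpleGraph.induce_adj.1 hadj)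
          have h2 : b.1 ≠ l := fun e => hl (e ▸ b.2)
          rw [ne_eq, Fin.ext_iff] at h2
          rw [Fin.lt_def] at ha ⊢
          omega
      have h1 : i < l := lt_of_le_of_ne hil fun e => hl (e ▸ hi)
      exact absurd (key w h1) (not_lt.2 hlj)
  · rintro ⟨⟨i₀, hi₀⟩, hB⟩
    have key : ∀ d : ℕ, ∀ x y : (B : Set (Fin n)), (x.1 : ℕ) + d = y.1 →
        ((coxeterGraph (CoxeterMatrix.A n)).induce (B : Set (Fin n))).Reachable x y := by
      intro d
      induction d with
      | zero =>
        intro x y h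
        rw [show x = y from Subtype.ext (Fin.ext h)]
      | succ d ih =>
        intro x y h
        have hz : (x.1 : ℕ) + d < n := by omega
        have hzB : (⟨x.1 + d, hz⟩ : Fin n) ∈ B :=
          hB x.1 x.2 y.1 y.2 _ (Fin.le_def.2 (by simp)) (Fin.le_def.2 (by simp; omega))
        refine (ih x ⟨_, hzB⟩ rfl).trans (SimpleGraph.Adj.reachable ?_)
        exact SimpleGraph.induce_adj.2 (coxeterGraph_A_adj.2 (Or.inl (by simp; omega)))
    refine { preconnected := fun x y => ?_, nonempty := ⟨⟨i₀, hi₀⟩⟩ }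
    rcases le_total x.1 y.1 with h | h
    · exact key (y.1 - x.1) x y (by rw [Fin.le_def] at h; omega)
    · exact (key (x.1 - y.1) y x (by rw [Fin.le_def] at h; omega)).symm

theorem isConnSub_interval {μ ν : Fin (n + 2)} (h : (μ : ℕ) + 2 ≤ ν) :
    IsConnSub (coxeterGraph (CoxeterMatrix.A n)) (interval μ ν) := by
  refine isConnSub_iff_convex.2 ⟨interval_nonempty.2 h, fun i hi j hj l hil hlj => ?_⟩
  rw [mem_interval] at hi hj ⊢
  rw [Fin.le_def] at hil hlj
  omega

theorem exists_eq_interval {B : Finset (Fin n)}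
    (hB : IsConnSub (coxeterGraph (CoxeterMatrix.A n)) B) :
    ∃ μ ν : Fin (n + 2), (μ : ℕ) + 2 ≤ ν ∧ B = interval μ ν := by
  obtain ⟨hne, hc⟩ := isConnSub_iff_convex.1 hB
  have h1 : (B.min' hne : ℕ) ≤ B.max' hne := Fin.le_def.1 (B.min'_le_max' hne)
  refine ⟨⟨B.min' hne, by omega⟩, ⟨B.max' hne + 2, by omega⟩, by simpa using h1, ?_⟩
  ext i
  simp only [mem_interval]
  constructor
  · intro hi
    have h2 := Fin.le_def.1 (B.min'_le i hi)
    have h3 := Fin.le_def.1 (B.le_max' i hi)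
    omega
  · intro hi
    exact hc _ (B.min'_mem hne) _ (B.max'_mem hne) i (Fin.le_def.2 hi.1) (Fin.le_def.2 (by omega))

/-- Removing a vertex `β` from an interval leaves at most two components, on either side. -/
theorem isComponent_erase_iff {μ ν : Fin (n + 2)} {β : Fin n} (hβ : β ∈ interval μ ν)
    {C : Finset (Fin n)} :
    IsComponent (coxeterGraph (CoxeterMatrix.A n)) ((interval μ ν).erase β) C ↔
      (C = interval μ (cutAt β) ∨ C = interval (cutAt β) ν) ∧ C.Nonempty := by
  rw [mem_interval] at hβ
  have side : ∀ C', IsConnSub (coxeterGraph (CoxeterMatrix.A n)) C' →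
      C' ⊆ (interval μ ν).erase β → ∀ i ∈ C', ∀ j ∈ C', i < β → j < β := by
    intro C' h1 h2 i hi j hj hlt
    by_contra hge
    exact (mem_erase.1 (h2 ((isConnSub_iff_convex.1 h1).2 i hi j hj β hlt.le (not_lt.1 hge)))).1 rfl
  have hL : interval μ (cutAt β) ⊆ (interval μ ν).erase β := fun i hi => by
    simp only [mem_interval, val_cutAt, mem_erase, ne_eq, Fin.ext_iff] at hi ⊢
    omega
  have hR : interval (cutAt β) ν ⊆ (interval μ ν).erase β := fun i hi => by
    simp only [mem_interval, val_cutAt, mem_erase, ne_eq, Fin.ext_iff] at hi ⊢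
    omega
  have inL : ∀ i ∈ (interval μ ν).erase β, i < β → i ∈ interval μ (cutAt β) := fun i hi h => by
    simp only [mem_interval, val_cutAt, mem_erase, ne_eq, Fin.ext_iff, Fin.lt_def] at hi h ⊢
    omega
  have inR : ∀ i ∈ (interval μ ν).erase β, ¬ i < β → i ∈ interval (cutAt β) ν := fun i hi h => by
    simp only [mem_interval, val_cutAt, mem_erase, ne_eq, Fin.ext_iff, Fin.lt_def] at hi h ⊢
    omega
  constructor
  · intro h
    have hne := (isConnSub_iff_convex.1 h.prop.1).1
    refine ⟨?_, hne⟩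
    obtain ⟨i, hi⟩ := hne
    by_cases hlt : i < β
    · have hsub : C ⊆ interval μ (cutAt β) := fun j hj =>
        inL j (h.prop.2 hj) (side C h.prop.1 h.prop.2 i hi j hj hlt)
      have hc := isConnSub_interval (interval_nonempty.1 ⟨i, hsub hi⟩)
      exact Or.inl (Maximal.eq_of_le h ⟨hc, hL⟩ hsub)
    · have hsub : C ⊆ interval (cutAt β) ν := fun j hj =>
        inR j (h.prop.2 hj) fun hj' => hlt (side C h.prop.1 h.prop.2 j hj i hi hj')
      have hc := isConnSub_interval (interval_nonempty.1 ⟨i, hsub hi⟩)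
      exact Or.inr (Maximal.eq_of_le h ⟨hc, hR⟩ hsub)
  · rintro ⟨rfl | rfl, hne⟩
    · refine ⟨⟨isConnSub_interval (interval_nonempty.1 hne), hL⟩, fun C' hC' hle j hj => ?_⟩
      obtain ⟨i, hi⟩ := hne
      refine inL j (hC'.2 hj) (side C' hC'.1 hC'.2 i (hle hi) j hj ?_)
      simp only [mem_interval, val_cutAt] at hi
      exact Fin.lt_def.2 (by omega)
    · refine ⟨⟨isConnSub_interval (interval_nonempty.1 hne), hR⟩, fun C' hC' hle j hj => ?_⟩
      obtain ⟨i, hi⟩ := hne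
      refine inR j (hC'.2 hj) fun hj' => ?_
      have := side C' hC'.1 hC'.2 j hj i (hle hi) hj'
      simp only [mem_interval, val_cutAt, Fin.lt_def] at hi this
      omega

theorem exists_isComponent {V : Type*} [Finite V] {D : SimpleGraph V} {B : Finset V} {i : V}
    (hi : i ∈ B) : ∃ C, IsComponent D B C ∧ i ∈ C := by
  have h1 : IsConnSub D {i} := by
    unfold IsConnSub
    rw [coe_singleton]
    exact { preconnected := fun x y => by
              rw [show x = y from Subtype.ext (x.2.trans y.2.symm)]
            nonempty := ⟨⟨i, rfl⟩⟩ }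
  obtain ⟨C, hC, hC'⟩ := Finite.exists_le_maximal
    (p := fun C' : Finset V => IsConnSub D C' ∧ C' ⊆ B) (a := {i})
    ⟨h1, singleton_subset_iff.2 hi⟩
  exact ⟨C, hC', hC (mem_singleton_self i)⟩

/-- The parabolic subgroup of an interval consists of the permutations moving only points between
the cuts. -/
theorem mem_parabolic_interval {μ ν : Fin (n + 2)} {h : Perm (Fin (n + 1))} :
    h ∈ parabolic (simpleA n) (interval μ ν) ↔
      ∀ x, h x ≠ x → (μ : ℕ) ≤ x ∧ (x : ℕ) < ν := by
  constructor
  · intro hh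
    induction hh using Subgroup.closure_induction with
    | mem g hg =>
      obtain ⟨i, hi, rfl⟩ := hg
      rw [mem_coe, mem_interval] at hi
      intro x hx
      by_contra hno
      refine hx ?_
      rcases lt_or_ge (x : ℕ) i with h | h
      · exact simpleA_apply_of_lt h
      · exact simpleA_apply_of_gt (by omega)
    | one => intro x hx; exact absurd rfl hx
    | mul a b _ _ ha hb =>
      intro x hx
      by_cases hbx : b x = x
      · exact ha x fun e => hx (by rw [Perm.mul_apply, hbx, e])
      · exact hb x hbx
    | inv a _ ha =>
      intro x hx
      exact ha x fun e => hx (by rw [Perm.inv_eq_iff_eq, e])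
  · intro hh
    have hS : ∀ f ∈ simpleA n '' (interval μ ν : Set (Fin n)), f.IsSwap := by
      rintro _ ⟨i, -, rfl⟩
      exact ⟨_, _, (Fin.castSucc_lt_succ (i := i)).ne, rfl⟩
    have orb : ∀ x y : Fin (n + 1), (μ : ℕ) ≤ x → x ≤ y → (y : ℕ) < ν →
        y ∈ MulAction.orbit (parabolic (simpleA n) (interval μ ν)) x := by
      intro x y hx
      induction y using Fin.induction with
      | zero =>
        intro hxy _
        rw [Fin.le_zero_iff.1 hxy]
        exact MulAction.mem_orbit_self _
      | succ i ih =>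
        intro hxy hy
        rcases hxy.eq_or_lt with e | e
        · rw [e]; exact MulAction.mem_orbit_self _
        · rw [Fin.lt_def] at e
          simp only [Fin.val_succ] at e hy
          have h1 := ih (Fin.le_def.2 (by simp; omega)) (by simp; omega)
          have hi : simpleA n i ∈ parabolic (simpleA n) (interval μ ν) :=
            Subgroup.subset_closure ⟨i, by rw [mem_coe, mem_interval]; omega, rfl⟩
          have h2 := MulAction.mem_orbit_of_mem_orbit
            (⟨simpleA n i, hi⟩ : parabolic (simpleA n) (interval μ ν)) h1
          rwa [show (⟨simpleA n i, hi⟩ : parabolic (simpleA n) (interval μ ν)) • i.castSucc =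
            i.succ from simpleA_castSucc i] at h2
    refine (mem_closure_isSwap hS).2 ⟨Set.toFinite _, fun x => ?_⟩
    change h x ∈ MulAction.orbit (parabolic (simpleA n) (interval μ ν)) x
    by_cases hx : h x = x
    · rw [hx]; exact MulAction.mem_orbit_self _
    · have h1 := hh x hx
      have h2 := hh (h x) fun e => hx (h.injective e)
      rcases le_total x (h x) with hle | hle
      · exact orb _ _ h1.1 hle h2.2
      · rw [MulAction.mem_orbit_symm]; exact orb _ _ h2.1 hle h1.2

end Diagram

/-! ### Centralizers in the group algebra -/

section GroupAlgebra

variable {k : Type*} [Field k] {I W : Type*} [Group W] (M : CoxeterMatrix I) (s : I → W)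
  (hs : M.IsLiftable s)

theorem mem_sub_iff {B : Finset I} {x : MonoidAlgebra k W} :
    x ∈ (groupDAlgebra k M s hs).sub B ↔ ∀ h, x.coeff h ≠ 0 → h ∈ parabolic s B := by
  change x ∈ (MonoidAlgebra.mapDomainAlgHom k k (parabolic s B).subtype).range ↔ _
  constructor
  · rintro ⟨y, rfl⟩ h hh
    by_contra hno
    exact hh (Finsupp.mapDomain_of_notMem_range _ _ fun ⟨z, hz⟩ => hno (hz ▸ z.2))
  · intro h
    refine ⟨MonoidAlgebra.comapDomain _ (parabolic s B).subtype_injective x, ?_⟩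
    exact MonoidAlgebra.mapDomain_comapDomain
      (fun w hw => ⟨⟨w, h w (Finsupp.mem_support_iff.1 hw)⟩, rfl⟩) _

/-- The centralizer condition in terms of coefficients: invariance under conjugation by the simple
reflections in `B₂`. -/
theorem mem_cent_iff [Finite I] (hinv : ∀ i, (s i)⁻¹ = s i) {B₁ B₂ : Finset I}
    {x : MonoidAlgebra k W} :
    x ∈ (groupDAlgebra k M s hs).cent B₁ B₂ ↔
      (∀ h, x.coeff h ≠ 0 → h ∈ parabolic s B₁) ∧
      ∀ i ∈ B₂, ∀ h, x.coeff (s i * h * s i) = x.coeff h := by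
  have hcomm : ∀ w : W, MonoidAlgebra.single w (1 : k) * x = x * MonoidAlgebra.single w 1 ↔
      ∀ h, x.coeff (w * h * w⁻¹) = x.coeff h := by
    intro w
    constructor
    · intro e h
      have := congrArg (fun y => MonoidAlgebra.coeff y (w * h)) e
      simpa using this.symm
    · intro e
      ext h
      have := e (w⁻¹ * h)
      simpa using this.symm
  rw [DAlgebra.cent, Algebra.mem_inf, mem_sub_iff, Subalgebra.mem_centralizer_iff]
  refine and_congr_right fun _ => ⟨fun hx i hi h => ?_, fun hx y hy => ?_⟩
  · obtain ⟨C, hC, hiC⟩ := exists_isComponent (D := coxeterGraph M) hi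
    have h1 := hx (MonoidAlgebra.single (s i) 1) ⟨C, hC, (mem_sub_iff M s hs).2 fun h hh => by
      have : h = s i := by
        by_contra hne
        exact hh (by simp [MonoidAlgebra.coeff_single, Ne.symm hne])
      rw [this]
      exact Subgroup.subset_closure ⟨i, hiC, rfl⟩⟩
    simpa [hinv] using (hcomm (s i)).1 h1 h
  · obtain ⟨C, hC, hy⟩ := hy
    rw [mem_sub_iff] at hy
    have hpar : ∀ w ∈ parabolic s C, ∀ h, x.coeff (w * h * w⁻¹) = x.coeff h := by
      intro w hw
      induction hw using Subgroup.closure_induction with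
      | mem g hg =>
        obtain ⟨i, hi, rfl⟩ := hg
        intro h
        rw [hinv]
        exact hx i (hC.prop.2 hi) h
      | one => simp
      | mul a b _ _ ha hb =>
        intro h
        rw [← hb h, ← ha (b * h * b⁻¹)]
        group
      | inv a _ ha =>
        intro h
        rw [← ha (a⁻¹ * h * a⁻¹⁻¹)]
        group
    ext h
    rw [MonoidAlgebra.coeff_mul_apply_left, MonoidAlgebra.coeff_mul_apply_right]
    refine Finsupp.sum_congr fun w hw => ?_
    have := hpar w (hy w (Finsupp.mem_support_iff.1 hw)) (w⁻¹ * h)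
    rw [mul_inv_cancel_left] at this
    rw [this, mul_comm]

end GroupAlgebra

/-! ### Dynkin cochains in terms of cuts -/

section Translation

variable {n : ℕ}

/-- The set of cuts attached to `B = interval μ ν` and `α ⊆ B`. -/
def cuts (μ ν : Fin (n + 2)) (α : Finset (Fin n)) : Finset (Fin (n + 2)) :=
  insert μ (insert ν (α.map ⟨cutAt, cutAt_injective⟩))

theorem mem_cuts {μ ν c : Fin (n + 2)} {α : Finset (Fin n)} :
    c ∈ cuts μ ν α ↔ c = μ ∨ c = ν ∨ ∃ i ∈ α, cutAt i = c := by
  simp [cuts]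

/-- The subdiagram `B` attached to a set of cuts: the reflections exchanging adjacent points which
both lie between the extremal cuts. -/
def diagramOf (t : Finset (Fin (n + 2))) : Finset (Fin n) :=
  {i | (∃ c ∈ t, (c : ℕ) ≤ i) ∧ ∃ c ∈ t, (i : ℕ) + 1 < c}

/-- The subset `α` attached to a set of cuts: its interior elements. -/
def verticesOf (t : Finset (Fin (n + 2))) : Finset (Fin n) :=
  {i | cutAt i ∈ t ∧ (∃ c ∈ t, (c : ℕ) ≤ i) ∧ ∃ c ∈ t, (i : ℕ) + 1 < c}

/-- The set of cuts attached to a pair `(B, α)`, in terms of the extremal elements of `B`. -/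
def cutsOf (B α : Finset (Fin n)) : Finset (Fin (n + 2)) :=
  {c | (∃ i ∈ α, cutAt i = c) ∨ (∃ i ∈ B, (c : ℕ) = i ∧ ∀ j ∈ B, i ≤ j) ∨
    ∃ i ∈ B, (c : ℕ) = i + 2 ∧ ∀ j ∈ B, j ≤ i}

theorem diagramOf_cuts {μ ν : Fin (n + 2)} {α : Finset (Fin n)} (hμν : μ < ν)
    (hα : α ⊆ interval μ ν) : diagramOf (cuts μ ν α) = interval μ ν := by
  rw [Fin.lt_def] at hμν
  ext i
  simp only [diagramOf, mem_filter, mem_univ, true_and, mem_cuts, mem_interval]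
  constructor
  · rintro ⟨⟨c, hc, hc'⟩, d, hd, hd'⟩
    constructor
    · rcases hc with rfl | rfl | ⟨j, hj, rfl⟩
      · exact hc'
      · omega
      · have := mem_interval.1 (hα hj)
        rw [val_cutAt] at hc'; omega
    · rcases hd with rfl | rfl | ⟨j, hj, rfl⟩
      · omega
      · exact hd'
      · have := mem_interval.1 (hα hj)
        rw [val_cutAt] at hd'; omega
  · intro h
    exact ⟨⟨μ, Or.inl rfl, h.1⟩, ν, Or.inr (Or.inl rfl), h.2⟩

theorem verticesOf_cuts {μ ν : Fin (n + 2)} {α : Finset (Fin n)} (hμν : μ < ν)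
    (hα : α ⊆ interval μ ν) : verticesOf (cuts μ ν α) = α := by
  have h := diagramOf_cuts hμν hα
  ext i
  have hi := Finset.ext_iff.1 h i
  simp only [diagramOf, mem_filter, mem_univ, true_and] at hi
  simp only [verticesOf, mem_filter, mem_univ, true_and, hi]
  rw [mem_cuts, mem_interval]
  constructor
  · rintro ⟨rfl | rfl | ⟨j, hj, e⟩, h1, h2⟩
    · rw [val_cutAt] at h1; omega
    · rw [val_cutAt] at h2; omega
    · exact cutAt_injective e ▸ hj
  · intro h
    exact ⟨Or.inr (Or.inr ⟨i, h, rfl⟩), mem_interval.1 (hα h)⟩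

theorem card_cuts {μ ν : Fin (n + 2)} {α : Finset (Fin n)} (hμν : μ < ν)
    (hα : α ⊆ interval μ ν) : (cuts μ ν α).card = α.card + 2 := by
  have h1 : ∀ i ∈ α, (μ : ℕ) < cutAt i ∧ (cutAt i : ℕ) < ν := fun i hi => by
    have := mem_interval.1 (hα hi)
    rw [val_cutAt]; omega
  rw [cuts, card_insert_of_notMem, card_insert_of_notMem, card_map]
  · intro h
    obtain ⟨i, hi, e⟩ := mem_map.1 h
    have := (h1 i hi).2
    exact this.ne (congrArg Fin.val e)
  · intro h
    rcases mem_insert.1 h with e | h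
    · exact hμν.ne e
    · obtain ⟨i, hi, e⟩ := mem_map.1 h
      exact (h1 i hi).1.ne' (congrArg Fin.val e)

theorem cutsOf_interval {μ ν : Fin (n + 2)} (hμν : (μ : ℕ) + 2 ≤ ν) (α : Finset (Fin n)) :
    cutsOf (interval μ ν) α = cuts μ ν α := by
  ext c
  simp only [cutsOf, mem_filter, mem_univ, true_and, mem_cuts]
  constructor
  · rintro (h | ⟨i, hi, hc, hmin⟩ | ⟨i, hi, hc, hmax⟩)
    · exact Or.inr (Or.inr h)
    · left
      rw [mem_interval] at hi
      have := Fin.le_def.1 (hmin ⟨μ, by omega⟩ (by rw [mem_interval]; simp; omega))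
      simp at this
      exact Fin.ext (by omega)
    · right; left
      rw [mem_interval] at hi
      have := Fin.le_def.1 (hmax ⟨ν - 2, by omega⟩ (by rw [mem_interval]; simp; omega))
      simp at this
      exact Fin.ext (by omega)
  · rintro (rfl | rfl | h)
    · refine Or.inr (Or.inl ⟨⟨c, by omega⟩, by rw [mem_interval]; simp; omega, rfl, fun j hj => ?_⟩)
      rw [mem_interval] at hj
      exact Fin.le_def.2 hj.1
    · refine Or.inr (Or.inr ⟨⟨c - 2, by omega⟩, by rw [mem_interval]; simp; omega, by simp; omega,
        fun j hj => ?_⟩)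
      rw [mem_interval] at hj
      exact Fin.le_def.2 (by simp; omega)
    · exact Or.inl h

theorem exists_eq_cuts {t : Finset (Fin (n + 2))} (ht : ∃ x ∈ t, ∃ y ∈ t, (x : ℕ) + 2 ≤ y) :
    ∃ (μ ν : Fin (n + 2)) (α : Finset (Fin n)), (μ : ℕ) + 2 ≤ ν ∧ α ⊆ interval μ ν ∧
      t = cuts μ ν α := by
  obtain ⟨x, hx, y, hy, hxy⟩ := ht
  have hne : t.Nonempty := ⟨x, hx⟩
  have h1 := fun c hc => Fin.le_def.1 (t.min'_le c hc)
  have h2 := fun c hc => Fin.le_def.1 (t.le_max' c hc)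
  let α : Finset (Fin n) := {i | cutAt i ∈ t ∧ i ∈ interval (t.min' hne) (t.max' hne)}
  refine ⟨t.min' hne, t.max' hne, α, ?_, fun i hi => (mem_filter.1 hi).2.2, ?_⟩
  · have := h1 x hx
    have := h2 y hy
    omega
  · ext c
    rw [mem_cuts]
    constructor
    · intro hc
      by_cases e1 : c = t.min' hne
      · exact Or.inl e1
      by_cases e2 : c = t.max' hne
      · exact Or.inr (Or.inl e2)
      have h3 := h1 c hc
      have h4 := h2 c hc
      rw [Fin.ext_iff] at e1 e2
      have hcn : (c : ℕ) - 1 < n := by omega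
      have e : cutAt ⟨c - 1, hcn⟩ = c := Fin.ext (by simp; omega)
      refine Or.inr (Or.inr ⟨⟨c - 1, hcn⟩, ?_, e⟩)
      simp only [α, mem_filter, mem_univ, true_and, e, mem_interval]
      exact ⟨hc, by omega, by omega⟩
    · rintro (rfl | rfl | ⟨i, hi, rfl⟩)
      · exact t.min'_mem hne
      · exact t.max'_mem hne
      · exact (mem_filter.1 hi).2.1

theorem two_le_of_diagramOf {t : Finset (Fin (n + 2))} (h : (diagramOf t).Nonempty) :
    ∃ x ∈ t, ∃ y ∈ t, (x : ℕ) + 2 ≤ y := by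
  obtain ⟨i, hi⟩ := h
  obtain ⟨⟨c, hc, hc'⟩, d, hd, hd'⟩ := (mem_filter.1 hi).2
  exact ⟨c, hc, d, hd, by omega⟩

variable {k : Type*} [Field k]

/-- A Dynkin cochain as a function of sets of cuts and permutations. -/
def toCut (a : Finset (Fin n) → Finset (Fin n) → MonoidAlgebra k (Perm (Fin (n + 1))))
    (t : Finset (Fin (n + 2))) (h : Perm (Fin (n + 1))) : k :=
  (a (diagramOf t) (verticesOf t)).coeff h

theorem toCut_cuts (a : Finset (Fin n) → Finset (Fin n) → MonoidAlgebra k (Perm (Fin (n + 1))))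
    {μ ν : Fin (n + 2)} {α : Finset (Fin n)} (hμν : μ < ν) (hα : α ⊆ interval μ ν)
    (h : Perm (Fin (n + 1))) : toCut a (cuts μ ν α) h = (a (interval μ ν) α).coeff h := by
  rw [toCut, diagramOf_cuts hμν hα, verticesOf_cuts hμν hα]

open Classical in
/-- The Dynkin `p`-cochain with given values on sets of cuts. -/
noncomputable def fromCut (p : ℕ) (b : Finset (Fin (n + 2)) → Perm (Fin (n + 1)) → k) :
    Finset (Fin n) → Finset (Fin n) → MonoidAlgebra k (Perm (Fin (n + 1))) := fun B α =>
  if IsConnSub (coxeterGraph (CoxeterMatrix.A n)) B ∧ α ⊆ B ∧ α.card = p then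
    MonoidAlgebra.ofCoeff (Finsupp.equivFunOnFinite.symm (b (cutsOf B α)))
  else 0

/-- The Dynkin cochains of type `A` with values in the span of `c`. -/
noncomputable abbrev cochainsA (k : Type*) [Field k] (n : ℕ) (c : Set (Perm (Fin (n + 1))))
    (p : ℕ) :
    Submodule k (Finset (Fin n) → Finset (Fin n) → MonoidAlgebra k (Perm (Fin (n + 1)))) :=
  classCochains k (CoxeterMatrix.A n) (simpleA n) (simpleA_isLiftable n) c p

/-- The Dynkin differential of type `A`. -/
noncomputable abbrev differentialA (k : Type*) [Field k] (n : ℕ) :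
    (Finset (Fin n) → Finset (Fin n) → MonoidAlgebra k (Perm (Fin (n + 1)))) →ₗ[k]
      (Finset (Fin n) → Finset (Fin n) → MonoidAlgebra k (Perm (Fin (n + 1)))) :=
  differential k (coxeterGraph (CoxeterMatrix.A n))

theorem coeff_eq_zero_of_mem_cochainsA {c : Set (Perm (Fin (n + 1)))} {p : ℕ}
    {a : Finset (Fin n) → Finset (Fin n) → MonoidAlgebra k (Perm (Fin (n + 1)))}
    (ha : a ∈ cochainsA k n c p) {B α : Finset (Fin n)}
    (h : ¬ (IsConnSub (coxeterGraph (CoxeterMatrix.A n)) B ∧ α ⊆ B ∧ α.card = p)) : a B α = 0 :=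
  ha.1.2 B α h

/-- Cochains supported on pairs `(B, α)` with `B` connected and `α ⊆ B` are determined by their
values on sets of cuts. -/
theorem ext_of_toCut {a a' : Finset (Fin n) → Finset (Fin n) → MonoidAlgebra k (Perm (Fin (n + 1)))}
    (ha : ∀ B α, ¬ (IsConnSub (coxeterGraph (CoxeterMatrix.A n)) B ∧ α ⊆ B) → a B α = 0)
    (ha' : ∀ B α, ¬ (IsConnSub (coxeterGraph (CoxeterMatrix.A n)) B ∧ α ⊆ B) → a' B α = 0)
    (h : ∀ t w, toCut a t w = toCut a' t w) : a = a' := by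
  funext B α
  by_cases hB : IsConnSub (coxeterGraph (CoxeterMatrix.A n)) B ∧ α ⊆ B
  · obtain ⟨μ, ν, hμν, rfl⟩ := exists_eq_interval hB.1
    have hlt : μ < ν := Fin.lt_def.2 (by omega)
    ext w
    rw [← toCut_cuts a hlt hB.2, ← toCut_cuts a' hlt hB.2, h]
  · rw [ha B α hB, ha' B α hB]

theorem isClassCochain_toCut {c : Set (Perm (Fin (n + 1)))} {p : ℕ}
    {a : Finset (Fin n) → Finset (Fin n) → MonoidAlgebra k (Perm (Fin (n + 1)))}
    (ha : a ∈ cochainsA k n c p) : IsClassCochain c (p + 2) (toCut a) := by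
  have key : ∀ t h, toCut a t h ≠ 0 → ∃ (μ ν : Fin (n + 2)) (α : Finset (Fin n)),
      (μ : ℕ) + 2 ≤ ν ∧ α ⊆ interval μ ν ∧ t = cuts μ ν α ∧ α.card = p := by
    intro t h hne
    have h1 : IsConnSub (coxeterGraph (CoxeterMatrix.A n)) (diagramOf t) ∧
        verticesOf t ⊆ diagramOf t ∧ (verticesOf t).card = p := by
      by_contra hno
      exact hne (by rw [toCut, coeff_eq_zero_of_mem_cochainsA ha hno]; rfl)
    obtain ⟨μ, ν, α, hμν, hα, rfl⟩ :=
      exists_eq_cuts (two_le_of_diagramOf (isConnSub_iff_convex.1 h1.1).1)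
    rw [verticesOf_cuts (Fin.lt_def.2 (by omega)) hα] at h1
    exact ⟨μ, ν, α, hμν, hα, rfl, h1.2.2⟩
  have hcent : ∀ (μ ν : Fin (n + 2)) (α : Finset (Fin n)), (μ : ℕ) + 2 ≤ ν → α ⊆ interval μ ν →
      α.card = p → _ := fun μ ν α hμν hα hp =>
    (mem_cent_iff _ _ _ simpleA_inv).1 (ha.1.1 (interval μ ν) α (isConnSub_interval hμν) hα hp)
  refine ⟨fun t h hne => ?_, fun t h hne => ?_, fun t h hne x hx => ?_, fun t h hne => ?_,
    fun t h i hi => ?_⟩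
  · obtain ⟨μ, ν, α, hμν, hα, rfl, hp⟩ := key t h hne
    rw [card_cuts (Fin.lt_def.2 (by omega)) hα, hp]
  · by_contra hc
    exact hne (ha.2 _ _ h hc)
  · obtain ⟨μ, ν, α, hμν, hα, rfl, hp⟩ := key t h hne
    rw [toCut_cuts a (Fin.lt_def.2 (by omega)) hα] at hne
    have h1 := mem_parabolic_interval.1 ((hcent μ ν α hμν hα hp).1 h hne) x hx
    exact ⟨⟨μ, mem_cuts.2 (Or.inl rfl), h1.1⟩, ν, mem_cuts.2 (Or.inr (Or.inl rfl)), h1.2⟩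
  · obtain ⟨μ, ν, α, hμν, hα, rfl, hp⟩ := key t h hne
    exact ⟨μ, mem_cuts.2 (Or.inl rfl), ν, mem_cuts.2 (Or.inr (Or.inl rfl)), hμν⟩
  · -- conjugation by a reflection either preserves the cochain or fixes the group element
    have conj : ∀ h : Perm (Fin (n + 1)),
        simpleA n i * (simpleA n i * h * simpleA n i) * simpleA n i = h := fun h => by
      simp only [← mul_assoc, simpleA_mul_self, one_mul]
      simp only [mul_assoc, simpleA_mul_self, mul_one]
    have main : ∀ h, toCut a t h ≠ 0 →
        toCut a t (simpleA n i * h * simpleA n i) = toCut a t h := by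
      intro h hne
      obtain ⟨μ, ν, α, hμν, hα, rfl, hp⟩ := key t h hne
      rw [toCut_cuts a (Fin.lt_def.2 (by omega)) hα] at hne ⊢
      rw [toCut_cuts a (Fin.lt_def.2 (by omega)) hα]
      have h1 := hcent μ ν α hμν hα hp
      by_cases hiB : i ∈ interval μ ν
      · refine h1.2 i (mem_sdiff.2 ⟨hiB, fun hiα => hi ?_⟩) h
        exact mem_cuts.2 (Or.inr (Or.inr ⟨i, hiα, rfl⟩))
      · have h2 := mem_parabolic_interval.1 (h1.1 h hne)
        have hμ : (μ : ℕ) ≠ i + 1 := fun e =>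
          hi (mem_cuts.2 (Or.inl (Fin.ext (by simp [e]))))
        have hν : (ν : ℕ) ≠ i + 1 := fun e =>
          hi (mem_cuts.2 (Or.inr (Or.inl (Fin.ext (by simp [e])))))
        rw [mem_interval] at hiB
        have hdisj : Perm.Disjoint h (simpleA n i) := by
          intro x
          by_cases hx : h x = x
          · exact Or.inl hx
          · right
            have := h2 x hx
            rcases lt_or_ge (x : ℕ) i with h' | h'
            · exact simpleA_apply_of_lt h'
            · exact simpleA_apply_of_gt (by omega)
        rw [← hdisj.commute.eq, mul_assoc, simpleA_mul_self, mul_one]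
    by_cases hz : toCut a t h = 0
    · by_contra hne
      rw [hz] at hne
      have := main _ hne
      rw [conj, hz] at this
      exact hne this.symm
    · exact main h hz

theorem toCut_fromCut {c : Set (Perm (Fin (n + 1)))} {p : ℕ}
    {b : Finset (Fin (n + 2)) → Perm (Fin (n + 1)) → k} (hb : IsClassCochain c (p + 2) b) (t h) :
    toCut (fromCut p b) t h = b t h := by
  by_cases ht : ∃ x ∈ t, ∃ y ∈ t, (x : ℕ) + 2 ≤ y
  · obtain ⟨μ, ν, α, hμν, hα, rfl⟩ := exists_eq_cuts ht
    have hlt : μ < ν := Fin.lt_def.2 (by omega)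
    rw [toCut_cuts _ hlt hα, fromCut]
    split_ifs with hc
    · rw [cutsOf_interval hμν]; rfl
    · by_contra hne
      refine hc ⟨isConnSub_interval hμν, hα, ?_⟩
      have := hb.card _ _ (Ne.symm hne)
      rw [card_cuts hlt hα] at this
      omega
  · have h1 : b t h = 0 := by
      by_contra hne
      exact ht (hb.two_le t h hne)
    have h2 : ¬ IsConnSub (coxeterGraph (CoxeterMatrix.A n)) (diagramOf t) := fun hc =>
      ht (two_le_of_diagramOf (isConnSub_iff_convex.1 hc).1)
    rw [h1, toCut, fromCut, if_neg fun h => h2 h.1]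
    rfl

theorem fromCut_mem {c : Set (Perm (Fin (n + 1)))} {p : ℕ}
    {b : Finset (Fin (n + 2)) → Perm (Fin (n + 1)) → k} (hb : IsClassCochain c (p + 2) b) :
    fromCut p b ∈ cochainsA k n c p := by
  refine ⟨⟨fun B α h1 h2 h3 => ?_, fun B α hno => if_neg hno⟩, fun B α g hg => ?_⟩
  · obtain ⟨μ, ν, hμν, rfl⟩ := exists_eq_interval h1
    have hlt : μ < ν := Fin.lt_def.2 (by omega)
    have e : ∀ h, (fromCut p b (interval μ ν) α).coeff h = b (cuts μ ν α) h := fun h => by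
      rw [← toCut_fromCut hb, toCut_cuts _ hlt h2]
    refine (mem_cent_iff _ _ _ simpleA_inv).2 ⟨fun h hne => ?_, fun i hi h => ?_⟩
    · rw [e] at hne
      refine mem_parabolic_interval.2 fun x hx => ?_
      have hcut : ∀ d ∈ cuts μ ν α, (μ : ℕ) ≤ d ∧ (d : ℕ) ≤ ν := fun d hd => by
        rcases mem_cuts.1 hd with rfl | rfl | ⟨j, hj, rfl⟩
        · omega
        · omega
        · have := mem_interval.1 (h2 hj)
          rw [val_cutAt]; omega
      obtain ⟨⟨d, hd, hd'⟩, d₂, hd₂, hd₂'⟩ := hb.encl _ _ hne x hx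
      have := hcut d hd
      have := hcut d₂ hd₂
      omega
    · rw [e, e]
      refine hb.inv _ _ i fun hi' => ?_
      rw [mem_sdiff, mem_interval] at hi
      rcases mem_cuts.1 hi' with e | e | ⟨j, hj, e⟩
      · have := congrArg Fin.val e
        rw [val_cutAt] at this; omega
      · have := congrArg Fin.val e
        rw [val_cutAt] at this; omega
      · exact hi.2 (cutAt_injective e ▸ hj)
  · rw [fromCut]
    split_ifs
    · by_contra hne
      exact hg (hb.mem _ _ hne)
    · rfl

end Translation

/-! ### The Dynkin differential in terms of cuts -/

section Differential

variable {n : ℕ} {k : Type*} [Field k]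

theorem cuts_erase_cutAt {μ ν : Fin (n + 2)} {α : Finset (Fin n)} (hα : α ⊆ interval μ ν)
    {β : Fin n} (hβ : β ∈ α) : (cuts μ ν α).erase (cutAt β) = cuts μ ν (α.erase β) := by
  have h1 := mem_interval.1 (hα hβ)
  ext c
  rw [mem_erase, mem_cuts, mem_cuts]
  constructor
  · rintro ⟨hne, rfl | rfl | ⟨j, hj, rfl⟩⟩
    · exact Or.inl rfl
    · exact Or.inr (Or.inl rfl)
    · exact Or.inr (Or.inr ⟨j, mem_erase.2 ⟨fun e => hne (e ▸ rfl), hj⟩, rfl⟩)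
  · rintro (rfl | rfl | ⟨j, hj, rfl⟩)
    · exact ⟨fun e => by have := congrArg Fin.val e; rw [val_cutAt] at this; omega, Or.inl rfl⟩
    · exact ⟨fun e => by have := congrArg Fin.val e; rw [val_cutAt] at this; omega,
        Or.inr (Or.inl rfl)⟩
    · exact ⟨fun e => (mem_erase.1 hj).1 (cutAt_injective e),
        Or.inr (Or.inr ⟨j, mem_of_mem_erase hj, rfl⟩)⟩

theorem cuts_erase_left {μ ν : Fin (n + 2)} {α : Finset (Fin n)} (hμν : μ < ν)
    (hα : α ⊆ interval μ ν) {β : Fin n} (hβ : β ∈ α) :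
    (cuts μ ν α).erase μ = cuts (cutAt β) ν (α.erase β) := by
  ext c
  rw [mem_erase, mem_cuts, mem_cuts]
  constructor
  · rintro ⟨hne, rfl | rfl | ⟨j, hj, rfl⟩⟩
    · exact absurd rfl hne
    · exact Or.inr (Or.inl rfl)
    · by_cases e : j = β
      · exact Or.inl (e ▸ rfl)
      · exact Or.inr (Or.inr ⟨j, mem_erase.2 ⟨e, hj⟩, rfl⟩)
  · have h1 : ∀ j ∈ α, cutAt j ≠ μ := fun j hj e => by
      have := mem_interval.1 (hα hj)
      have := congrArg Fin.val e
      rw [val_cutAt] at this; omega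
    rintro (rfl | rfl | ⟨j, hj, rfl⟩)
    · exact ⟨h1 β hβ, Or.inr (Or.inr ⟨β, hβ, rfl⟩)⟩
    · exact ⟨hμν.ne', Or.inr (Or.inl rfl)⟩
    · exact ⟨h1 j (mem_of_mem_erase hj), Or.inr (Or.inr ⟨j, mem_of_mem_erase hj, rfl⟩)⟩

theorem cuts_erase_right {μ ν : Fin (n + 2)} {α : Finset (Fin n)} (hμν : μ < ν)
    (hα : α ⊆ interval μ ν) {β : Fin n} (hβ : β ∈ α) :
    (cuts μ ν α).erase ν = cuts μ (cutAt β) (α.erase β) := by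
  ext c
  rw [mem_erase, mem_cuts, mem_cuts]
  constructor
  · rintro ⟨hne, rfl | rfl | ⟨j, hj, rfl⟩⟩
    · exact Or.inl rfl
    · exact absurd rfl hne
    · by_cases e : j = β
      · exact Or.inr (Or.inl (e ▸ rfl))
      · exact Or.inr (Or.inr ⟨j, mem_erase.2 ⟨e, hj⟩, rfl⟩)
  · have h1 : ∀ j ∈ α, cutAt j ≠ ν := fun j hj e => by
      have := mem_interval.1 (hα hj)
      have := congrArg Fin.val e
      rw [val_cutAt] at this; omega
    rintro (rfl | rfl | ⟨j, hj, rfl⟩)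
    · exact ⟨hμν.ne, Or.inl rfl⟩
    · exact ⟨h1 β hβ, Or.inr (Or.inr ⟨β, hβ, rfl⟩)⟩
    · exact ⟨h1 j (mem_of_mem_erase hj), Or.inr (Or.inr ⟨j, mem_of_mem_erase hj, rfl⟩)⟩

theorem mem_components {V : Type*} {D : SimpleGraph V} {B C : Finset V} :
    C ∈ components D B ↔ IsComponent D B C := by
  classical
  rw [components, mem_filter, mem_powerset]
  exact and_iff_right_of_imp fun h => h.prop.2

/-- A cochain vanishes at an empty set and at a set not containing `γ`, so the sum over the
components of an interval without `β` reduces to the two sides of `β`. -/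
theorem sum_components {c : Set (Perm (Fin (n + 1)))} {p : ℕ}
    {a : Finset (Fin n) → Finset (Fin n) → MonoidAlgebra k (Perm (Fin (n + 1)))}
    (ha : a ∈ cochainsA k n c p) {μ ν : Fin (n + 2)} {β : Fin n} (hβ : β ∈ interval μ ν)
    (γ : Finset (Fin n)) [DecidablePred fun C : Finset (Fin n) => γ ⊆ C] :
    ∑ C ∈ (components (coxeterGraph (CoxeterMatrix.A n)) ((interval μ ν).erase β)).filter
      (fun C => γ ⊆ C), a C γ = a (interval μ (cutAt β)) γ + a (interval (cutAt β) ν) γ := by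
  have h0 : ∀ C, ¬ (C.Nonempty ∧ γ ⊆ C) → a C γ = 0 := fun C hC =>
    coeff_eq_zero_of_mem_cochainsA ha fun h => hC ⟨(isConnSub_iff_convex.1 h.1).1, h.2.1⟩
  have hmem : ∀ C, C ∈ (components (coxeterGraph (CoxeterMatrix.A n))
      ((interval μ ν).erase β)).filter (fun C => γ ⊆ C) ↔
      ((C = interval μ (cutAt β) ∨ C = interval (cutAt β) ν) ∧ C.Nonempty) ∧ γ ⊆ C := fun C => by
    rw [mem_filter, mem_components, isComponent_erase_iff hβ]
  have hsub : ∑ C ∈ (components (coxeterGraph (CoxeterMatrix.A n))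
      ((interval μ ν).erase β)).filter (fun C => γ ⊆ C), a C γ =
      ∑ C ∈ {interval μ (cutAt β), interval (cutAt β) ν}, a C γ := by
    refine sum_subset (fun C hC => ?_) fun C hC hC' => h0 C fun h => hC' ?_
    · have := ((hmem C).1 hC).1.1
      simpa using this
    · exact (hmem C).2 ⟨⟨by simpa using hC, h.1⟩, h.2⟩
  rw [hsub]
  by_cases e : interval μ (cutAt β) = interval (cutAt β) ν
  · -- both sides of `β` are empty
    have hemp : ¬ (interval (cutAt β) ν).Nonempty := by
      rintro ⟨i, hi⟩
      have hi' := hi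
      rw [← e] at hi'
      rw [mem_interval] at hi hi'
      omega
    rw [e, pair_eq_singleton, sum_singleton, h0 _ fun h => hemp h.1, add_zero]
  · rw [sum_pair e]

/-- In terms of cuts the Dynkin differential is, up to sign, the simplicial coboundary: removing an
interior cut gives the terms `a (B, α ∖ αᵢ)`, removing an extremal cut gives the terms of the
components of `B ∖ αᵢ`. -/
theorem coeff_differentialA {c : Set (Perm (Fin (n + 1)))} {p : ℕ}
    {a : Finset (Fin n) → Finset (Fin n) → MonoidAlgebra k (Perm (Fin (n + 1)))}
    (ha : a ∈ cochainsA k n c p) {μ ν : Fin (n + 2)} (hμν : (μ : ℕ) + 2 ≤ ν)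
    {α : Finset (Fin n)} (hα : α ⊆ interval μ ν) (h : Perm (Fin (n + 1))) :
    (differentialA k n a (interval μ ν) α).coeff h =
      -cobd (fun t => toCut a t h) (cuts μ ν α) := by
  have hlt : μ < ν := Fin.lt_def.2 (by omega)
  have hB : ∀ β ∈ α, (μ : ℕ) < cutAt β ∧ (cutAt β : ℕ) < ν := fun β hβ => by
    have := mem_interval.1 (hα hβ)
    rw [val_cutAt]; omega
  have hL : differentialA k n a (interval μ ν) α = ∑ β ∈ α,
      (-1 : k) ^ #{γ ∈ α | γ < β} • (a (interval μ ν) (α.erase β) -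
        (a (interval μ (cutAt β)) (α.erase β) + a (interval (cutAt β) ν) (α.erase β))) := by
    refine (if_pos ⟨isConnSub_interval hμν, hα⟩).trans ?_
    exact sum_congr rfl fun β hβ => by rw [← sum_components ha (hα hβ) (α.erase β)]
  rw [hL, MonoidAlgebra.coeff_sum, Finsupp.finsetSum_apply]
  rcases α.eq_empty_or_nonempty with rfl | hne
  · have h1 : ∀ x : Fin (n + 2), toCut a {x} h = 0 := fun x => by
      by_contra hx
      obtain ⟨y, hy, z, hz, hyz⟩ := (isClassCochain_toCut ha).two_le _ _ hx
      rw [mem_singleton] at hy hz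
      subst hy; subst hz
      omega
    rw [sum_empty, show cuts μ ν ∅ = {μ, ν} from by simp [cuts], cobd_pair _ hlt, h1, h1]
    simp
  have hzero : ∀ {B γ : Finset (Fin n)}, ¬ γ ⊆ B → (a B γ).coeff h = 0 := fun hγ => by
    rw [coeff_eq_zero_of_mem_cochainsA ha fun h => hγ h.2.1]; rfl
  have cardmap : ∀ x : Fin (n + 2), #{y ∈ α.map ⟨cutAt, cutAt_injective⟩ | y < x} =
      #{γ ∈ α | cutAt γ < x} := fun x => by rw [filter_map, card_map]; rfl
  -- the term of the left-most cut
  have e1 : (-1 : k) ^ #{y ∈ cuts μ ν α | y < μ} * toCut a ((cuts μ ν α).erase μ) h =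
      ∑ β ∈ α, (-1 : k) ^ #{γ ∈ α | γ < β} *
        (a (interval (cutAt β) ν) (α.erase β)).coeff h := by
    have hmin := α.min'_mem hne
    have hempty : ({y ∈ cuts μ ν α | y < μ} : Finset (Fin (n + 2))) = ∅ := by
      refine filter_eq_empty_iff.2 fun y hy hyμ => ?_
      rcases mem_cuts.1 hy with rfl | rfl | ⟨j, hj, rfl⟩
      · exact lt_irrefl _ hyμ
      · exact hyμ.not_gt hlt
      · exact hyμ.not_gt (Fin.lt_def.2 (hB j hj).1)
    have hempty' : ({γ ∈ α | γ < α.min' hne} : Finset (Fin n)) = ∅ :=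
      filter_eq_empty_iff.2 fun y hy => not_lt.2 (α.min'_le y hy)
    rw [sum_eq_single_of_mem (α.min' hne) hmin, hempty, hempty', cuts_erase_left hlt hα hmin,
      toCut_cuts]
    · rfl
    · exact Fin.lt_def.2 (hB _ hmin).2
    · intro j hj
      rw [mem_erase] at hj
      have h1 := lt_of_le_of_ne (α.min'_le j hj.2) hj.1.symm
      have h2 := mem_interval.1 (hα hj.2)
      rw [Fin.lt_def] at h1
      rw [mem_interval, val_cutAt]
      omega
    · intro β hβ hne'
      rw [hzero, mul_zero]
      intro hsub
      have h1 := mem_interval.1 (hsub (mem_erase.2 ⟨hne'.symm, hmin⟩))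
      have h2 := Fin.le_def.1 (α.min'_le β hβ)
      rw [val_cutAt] at h1
      omega
  -- the term of the right-most cut
  have e2 : (-1 : k) ^ #{y ∈ cuts μ ν α | y < ν} * toCut a ((cuts μ ν α).erase ν) h =
      ∑ β ∈ α, (-1 : k) ^ #{γ ∈ α | γ < β} *
        (a (interval μ (cutAt β)) (α.erase β)).coeff h := by
    have hmax := α.max'_mem hne
    have hcard : #{y ∈ cuts μ ν α | y < ν} = #{γ ∈ α | γ < α.max' hne} + 2 := by
      have h1 : ({y ∈ cuts μ ν α | y < ν} : Finset (Fin (n + 2))) = (cuts μ ν α).erase ν := by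
        ext y
        rw [mem_filter, mem_erase]
        constructor
        · rintro ⟨hy, h⟩; exact ⟨h.ne, hy⟩
        · rintro ⟨h, hy⟩
          refine ⟨hy, ?_⟩
          rcases mem_cuts.1 hy with rfl | rfl | ⟨j, hj, rfl⟩
          · exact hlt
          · exact absurd rfl h
          · exact Fin.lt_def.2 (hB j hj).2
      have h2 : ({γ ∈ α | γ < α.max' hne} : Finset (Fin n)) = α.erase (α.max' hne) := by
        ext y
        rw [mem_filter, mem_erase]
        exact ⟨fun H => ⟨H.2.ne, H.1⟩, fun H => ⟨H.2, lt_of_le_of_ne (α.le_max' y H.2) H.1⟩⟩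
      have h3 := card_erase_add_one (mem_cuts.2 (Or.inr (Or.inl rfl)) : ν ∈ cuts μ ν α)
      rw [card_cuts hlt hα] at h3
      have h4 := card_erase_add_one hmax
      rw [h1, h2]
      omega
    rw [sum_eq_single_of_mem (α.max' hne) hmax, hcard, cuts_erase_right hlt hα hmax,
      toCut_cuts, pow_add]
    · simp
    · exact Fin.lt_def.2 (hB _ hmax).1
    · intro j hj
      rw [mem_erase] at hj
      have h1 := lt_of_le_of_ne (α.le_max' j hj.2) hj.1
      have h2 := mem_interval.1 (hα hj.2)
      rw [Fin.lt_def] at h1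
      rw [mem_interval, val_cutAt]
      omega
    · intro β hβ hne'
      rw [hzero, mul_zero]
      intro hsub
      have h1 := mem_interval.1 (hsub (mem_erase.2 ⟨hne'.symm, hmax⟩))
      have h2 := Fin.le_def.1 (α.le_max' β hβ)
      rw [val_cutAt] at h1
      omega
  -- the terms of the interior cuts
  have e3 : ∀ β ∈ α, (-1 : k) ^ #{y ∈ cuts μ ν α | y < cutAt β} *
      toCut a ((cuts μ ν α).erase (cutAt β)) h =
      -((-1 : k) ^ #{γ ∈ α | γ < β} * (a (interval μ ν) (α.erase β)).coeff h) := by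
    intro β hβ
    have h1 : ({y ∈ cuts μ ν α | y < cutAt β} : Finset (Fin (n + 2))) =
        insert μ ({y ∈ α.map ⟨cutAt, cutAt_injective⟩ | y < cutAt β} : Finset (Fin (n + 2))) := by
      rw [cuts, filter_insert, if_pos (Fin.lt_def.2 (hB β hβ).1), filter_insert,
        if_neg (not_lt.2 (Fin.le_def.2 (hB β hβ).2.le))]
    have h2 : μ ∉ ({y ∈ α.map ⟨cutAt, cutAt_injective⟩ | y < cutAt β} : Finset (Fin (n + 2))) := by
      intro hμ
      obtain ⟨j, hj, e⟩ := mem_map.1 (mem_filter.1 hμ).1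
      exact (hB j hj).1.ne' (congrArg Fin.val e)
    have h3 : ∀ γ : Fin n, cutAt γ < cutAt β ↔ γ < β := fun γ => by
      rw [Fin.lt_def, Fin.lt_def, val_cutAt, val_cutAt]; omega
    rw [h1, card_insert_of_notMem h2, cardmap, cuts_erase_cutAt hα hβ,
      toCut_cuts a hlt ((erase_subset _ _).trans hα)]
    simp only [h3]
    ring
  have hμ : μ ∉ insert ν (α.map ⟨cutAt, cutAt_injective⟩) := by
    intro hμ
    rcases mem_insert.1 hμ with e | hμ
    · exact hlt.ne e
    · obtain ⟨j, hj, e⟩ := mem_map.1 hμ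
      exact (hB j hj).1.ne' (congrArg Fin.val e)
  have hν : ν ∉ α.map ⟨cutAt, cutAt_injective⟩ := by
    intro hν
    obtain ⟨j, hj, e⟩ := mem_map.1 hν
    exact (hB j hj).2.ne (congrArg Fin.val e)
  have hcob : cobd (fun t => toCut a t h) (cuts μ ν α) =
      (-1 : k) ^ #{y ∈ cuts μ ν α | y < μ} * toCut a ((cuts μ ν α).erase μ) h +
      ((-1 : k) ^ #{y ∈ cuts μ ν α | y < ν} * toCut a ((cuts μ ν α).erase ν) h +
      ∑ β ∈ α, (-1 : k) ^ #{y ∈ cuts μ ν α | y < cutAt β} *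
        toCut a ((cuts μ ν α).erase (cutAt β)) h) := by
    unfold cobd
    conv_lhs => rw [cuts, sum_insert hμ, sum_insert hν, sum_map]
    rfl
  rw [hcob, e1, e2, sum_congr rfl e3, ← sum_add_distrib, ← sum_add_distrib, ← sum_neg_distrib]
  refine sum_congr rfl fun β _ => ?_
  simp
  ring

theorem differentialA_eq_zero_of_not
    (a : Finset (Fin n) → Finset (Fin n) → MonoidAlgebra k (Perm (Fin (n + 1))))
    (B α : Finset (Fin n)) (h : ¬ (IsConnSub (coxeterGraph (CoxeterMatrix.A n)) B ∧ α ⊆ B)) :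
    differentialA k n a B α = 0 :=
  if_neg h

theorem toCut_differentialA {c : Set (Perm (Fin (n + 1)))} {p : ℕ}
    {a : Finset (Fin n) → Finset (Fin n) → MonoidAlgebra k (Perm (Fin (n + 1)))}
    (ha : a ∈ cochainsA k n c p) (t : Finset (Fin (n + 2))) (h : Perm (Fin (n + 1))) :
    toCut (differentialA k n a) t h = -cobd (fun t => toCut a t h) t := by
  by_cases ht : ∃ x ∈ t, ∃ y ∈ t, (x : ℕ) + 2 ≤ y
  · obtain ⟨μ, ν, α, hμν, hα, rfl⟩ := exists_eq_cuts ht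
    rw [toCut_cuts _ (Fin.lt_def.2 (by omega)) hα, coeff_differentialA ha hμν hα]
  · rw [toCut, differentialA_eq_zero_of_not a _ _ fun hc =>
      ht (two_le_of_diagramOf (isConnSub_iff_convex.1 hc.1).1), cobd, sum_eq_zero fun x _ => ?_]
    · simp
    · by_contra hne
      obtain ⟨y, hy, z, hz, hyz⟩ :=
        (isClassCochain_toCut ha).two_le _ _ (right_ne_zero_of_mul hne)
      exact ht ⟨y, mem_of_mem_erase hy, z, mem_of_mem_erase hz, hyz⟩

end Differential

/-! ### Dimension of the cohomology of a class -/

section Rank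

variable {n : ℕ} {k : Type*} [Field k]

theorem cobd_toCut_eq_zero {c : Set (Perm (Fin (n + 1)))} {p : ℕ}
    {z : Finset (Fin n) → Finset (Fin n) → MonoidAlgebra k (Perm (Fin (n + 1)))}
    (hz : z ∈ cocycles (cochainsA k n c) (differentialA k n) p) (t : Finset (Fin (n + 2)))
    (h : Perm (Fin (n + 1))) : cobd (fun t => toCut z t h) t = 0 := by
  have h1 := toCut_differentialA hz.1 t h
  rw [LinearMap.mem_ker.1 hz.2] at h1
  exact neg_eq_zero.1 h1.symm

theorem eq_zero_off_of_mem_cochainsA {c : Set (Perm (Fin (n + 1)))} {p : ℕ}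
    {a : Finset (Fin n) → Finset (Fin n) → MonoidAlgebra k (Perm (Fin (n + 1)))}
    (ha : a ∈ cochainsA k n c p) (B α : Finset (Fin n))
    (h : ¬ (IsConnSub (coxeterGraph (CoxeterMatrix.A n)) B ∧ α ⊆ B)) : a B α = 0 :=
  coeff_eq_zero_of_mem_cochainsA ha fun h' => h ⟨h'.1, h'.2.1⟩

theorem mem_coboundaries_of_exists_cobd {c : Set (Perm (Fin (n + 1)))} {p : ℕ}
    {z : Finset (Fin n) → Finset (Fin n) → MonoidAlgebra k (Perm (Fin (n + 1)))}
    (hz : z ∈ cochainsA k n c p)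
    (hex : ∃ b : Finset (Fin (n + 2)) → Perm (Fin (n + 1)) → k,
      IsClassCochain c (p + 1) b ∧ ∀ t h, toCut z t h = cobd (fun t => b t h) t) :
    z ∈ coboundaries (cochainsA k n c) (differentialA k n) p := by
  obtain ⟨b, hb, hzb⟩ := hex
  cases p with
  | zero =>
    refine (Submodule.mem_bot k).2 (ext_of_toCut (eq_zero_off_of_mem_cochainsA hz)
      (fun _ _ _ => rfl) fun t h => ?_)
    rw [hzb]
    exact sum_eq_zero fun x _ => by
      simp only [hb.eq_zero_of_card_one, mul_zero]
  | succ p =>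
    have hy := fromCut_mem hb
    refine ⟨-fromCut p b, neg_mem hy, ext_of_toCut (differentialA_eq_zero_of_not _)
      (eq_zero_off_of_mem_cochainsA hz) fun t h => ?_⟩
    rw [hzb, toCut_differentialA (neg_mem hy)]
    have : (fun t => toCut (-fromCut p b) t h) = fun t => 0 - b t h := by
      funext t
      rw [← toCut_fromCut hb t h, zero_sub]
      rfl
    rw [this, cobd_sub (fun _ => (0 : k)) (fun t => b t h)]
    simp [cobd]

theorem fromCut_mem_cocycles {c : Set (Perm (Fin (n + 1)))} {p : ℕ}
    {b : Finset (Fin (n + 2)) → Perm (Fin (n + 1)) → k} (hb : IsClassCochain c (p + 2) b)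
    (hd : ∀ t h, cobd (fun t => b t h) t = 0) :
    fromCut p b ∈ cocycles (cochainsA k n c) (differentialA k n) p := by
  refine ⟨fromCut_mem hb, LinearMap.mem_ker.2 (ext_of_toCut (differentialA_eq_zero_of_not _)
    (fun _ _ _ => rfl) fun t h => ?_)⟩
  rw [toCut_differentialA (fromCut_mem hb)]
  simp only [toCut_fromCut hb, hd, neg_zero]
  rfl

theorem rank_cohomology_eq_zero {M : Type*} [AddCommGroup M] [Module k M]
    {K : ℕ → Submodule k M} {d : M →ₗ[k] M} {p : ℕ}
    (h : ∀ z ∈ cocycles K d p, z ∈ coboundaries K d p) : Module.rank k (Cohomology K d p) = 0 := by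
  have : (coboundaries K d p).submoduleOf (cocycles K d p) = ⊤ :=
    eq_top_iff.2 fun z _ => h z.1 z.2
  have hs : Subsingleton (Cohomology K d p) := Submodule.Quotient.subsingleton_iff.2 this
  exact rank_subsingleton' k _

theorem rank_cohomology_eq_one {M : Type*} [AddCommGroup M] [Module k M]
    {K : ℕ → Submodule k M} {d : M →ₗ[k] M} {p : ℕ} (φ : M →ₗ[k] k)
    (h : ∀ z ∈ cocycles K d p, z ∈ coboundaries K d p ↔ φ z = 0)
    (hne : ∃ z ∈ cocycles K d p, φ z ≠ 0) : Module.rank k (Cohomology K d p) = 1 := by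
  let ψ := φ.comp (cocycles K d p).subtype
  have hker : (coboundaries K d p).submoduleOf (cocycles K d p) = LinearMap.ker ψ := by
    ext z
    exact h z.1 z.2
  have hsurj : Function.Surjective ψ := by
    obtain ⟨z, hz, hz'⟩ := hne
    exact LinearMap.surjective fun h0 => hz' (congrArg (fun f => f ⟨z, hz⟩) h0)
  have e := (Submodule.quotEquivOfEq _ _ hker).trans (ψ.quotKerEquivOfSurjective hsurj)
  have := e.lift_rank_eq
  rw [Module.rank_self, Cardinal.lift_one, Cardinal.lift_eq_one] at this
  exact this

/-- Evaluation of Dynkin cochains at the fundamental cycle, through the conjugates of `g`. -/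
def pairingA (k : Type*) [Field k] (n m : ℕ) (g : Perm (Fin (n + 1))) :
    (Finset (Fin n) → Finset (Fin n) → MonoidAlgebra k (Perm (Fin (n + 1)))) →ₗ[k] k where
  toFun z := altPairing m fun t w => toCut z t (w⁻¹ * g * w)
  map_add' z z' := by
    simp only [altPairing, toCut, Pi.add_apply, MonoidAlgebra.coeff_add, Finsupp.add_apply, mul_add,
      sum_add_distrib]
  map_smul' r z := by
    simp only [altPairing, toCut, Pi.smul_apply, MonoidAlgebra.coeff_smul, Finsupp.smul_apply,
      smul_eq_mul, RingHom.id_apply, mul_sum, mul_left_comm]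

theorem pairingA_apply {m : ℕ} {g : Perm (Fin (n + 1))}
    (z : Finset (Fin n) → Finset (Fin n) → MonoidAlgebra k (Perm (Fin (n + 1)))) :
    pairingA k n m g z = altPairing m fun t w => toCut z t (w⁻¹ * g * w) := rfl

/-- The class of the identity does not contribute to Dynkin cohomology. -/
theorem rank_eq_zero_of_identity {p : ℕ} :
    Module.rank k (Cohomology (cochainsA k n {1}) (differentialA k n) p) = 0 :=
  rank_cohomology_eq_zero fun _ hz => mem_coboundaries_of_exists_cobd hz.1
    ((isClassCochain_toCut hz.1).exists_eq_cobd_one (by omega) (cobd_toCut_eq_zero hz))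

variable [CharZero k] {m : ℕ} {g : Perm (Fin (n + 1))}

theorem mem_coboundaries_of_pairingA (hm : 2 ≤ m) (hmn : m ≤ n + 1)
    (hg : ∀ x, g x ≠ x ↔ (x : ℕ) < m) {p : ℕ}
    {z : Finset (Fin n) → Finset (Fin n) → MonoidAlgebra k (Perm (Fin (n + 1)))}
    (hz : z ∈ cocycles (cochainsA k n {h | IsConj g h}) (differentialA k n) p)
    (h0 : pairingA k n m g z = 0) :
    z ∈ coboundaries (cochainsA k n {h | IsConj g h}) (differentialA k n) p :=
  mem_coboundaries_of_exists_cobd hz.1 ((isClassCochain_toCut hz.1).exists_eq_cobd hm hmn hg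
    (cobd_toCut_eq_zero hz) h0)

theorem pairingA_eq_zero_of_mem_coboundaries (hm : 2 ≤ m) (hmn : m ≤ n + 1)
    (hg : ∀ x, g x ≠ x ↔ (x : ℕ) < m) {p : ℕ}
    {z : Finset (Fin n) → Finset (Fin n) → MonoidAlgebra k (Perm (Fin (n + 1)))}
    (hz : z ∈ coboundaries (cochainsA k n {h | IsConj g h}) (differentialA k n) p) :
    pairingA k n m g z = 0 := by
  cases p with
  | zero =>
    rw [(Submodule.mem_bot k).1 hz, map_zero]
  | succ p =>
    obtain ⟨y, hy, rfl⟩ := hz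
    have h1 := altPairing_cobd (by omega) hmn ((isClassCochain_toCut hy).pullback hg)
    rw [← neg_eq_zero, ← h1]
    rw [pairingA_apply]
    simp only [altPairing, toCut_differentialA hy, mul_neg, sum_neg_distrib, neg_neg]

/-- Dynkin cohomology of the class of `g` vanishes if some odd permutation of its moved points
centralizes `g`, and in all degrees other than the number of moved points minus one. -/
theorem rank_eq_zero_of_conj (hm : 2 ≤ m) (hmn : m ≤ n + 1)
    (hg : ∀ x, g x ≠ x ↔ (x : ℕ) < m) {p : ℕ}
    (h : m = p + 1 → ∃ z : Perm {x : Fin (n + 1) // (x : ℕ) < m}, Perm.sign z = -1 ∧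
      Perm.ofSubtype z * g = g * Perm.ofSubtype z) :
    Module.rank k (Cohomology (cochainsA k n {h | IsConj g h}) (differentialA k n) p) = 0 := by
  refine rank_cohomology_eq_zero fun z hz => mem_coboundaries_of_pairingA hm hmn hg hz ?_
  by_cases hmp : m = p + 1
  · obtain ⟨u, hu, hug⟩ := h hmp
    exact altPairing_eq_zero_of_odd hu hug _
  · refine sum_eq_zero fun u _ => ?_
    have : toCut z (firstCuts n m) ((Perm.ofSubtype u)⁻¹ * g * Perm.ofSubtype u) = 0 := by
      by_contra hne
      have := (isClassCochain_toCut hz.1).card _ _ hne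
      rw [card_firstCuts hmn] at this
      omega
    simp only [this, mul_zero]

/-- Dynkin cohomology of the class of `g` in the degree `p` for which `g` moves `p + 1` points. -/
theorem rank_eq_one_of_conj {p : ℕ} (hm : 2 ≤ p + 1) (hmn : p + 1 ≤ n + 1)
    (hg : ∀ x, g x ≠ x ↔ (x : ℕ) < p + 1)
    (heven : ∀ (z : Perm (Fin (n + 1))) (hz : ∀ x, (z x : ℕ) < p + 1 ↔ (x : ℕ) < p + 1),
      z * g = g * z →
      Perm.sign (z.subtypePerm hz : Perm {x : Fin (n + 1) // (x : ℕ) < p + 1}) = 1) :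
    Module.rank k (Cohomology (cochainsA k n {h | IsConj g h}) (differentialA k n) p) = 1 := by
  refine rank_cohomology_eq_one (pairingA k n (p + 1) g) (fun z hz =>
    ⟨pairingA_eq_zero_of_mem_coboundaries hm hmn hg, mem_coboundaries_of_pairingA hm hmn hg hz⟩) ?_
  obtain ⟨b, hb, hd, hne⟩ := exists_cocycle_altPairing_ne_zero (k := k) hm hmn hg heven
  refine ⟨fromCut p b, fromCut_mem_cocycles hb hd, fun h0 => hne ?_⟩
  rw [← h0, pairingA_apply]
  simp only [toCut_fromCut hb]

end Rank

/-! ### Cycle types -/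

section CycleType

variable {n : ℕ}

theorem ofSubtype_apply_ne_iff {m : ℕ} {g : Perm {x : Fin (n + 1) // (x : ℕ) < m}}
    (hg : g.support = univ) (x : Fin (n + 1)) : Perm.ofSubtype g x ≠ x ↔ (x : ℕ) < m := by
  constructor
  · intro h
    by_contra hx
    exact h (Perm.ofSubtype_apply_of_not_mem g hx)
  · intro hx e
    rw [Perm.ofSubtype_apply_of_mem g hx] at e
    have : (⟨x, hx⟩ : {x : Fin (n + 1) // (x : ℕ) < m}) ∈ g.support := hg ▸ mem_univ _
    exact Perm.mem_support.1 this (Subtype.ext e)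

theorem card_subtype_val_lt {m : ℕ} (hmn : m ≤ n + 1) :
    Fintype.card {x : Fin (n + 1) // (x : ℕ) < m} = m := by
  rw [Fintype.card_subtype, card_filter_val_lt hmn]

theorem parts_eq_filter_add (lam : Nat.Partition (n + 1)) :
    lam.parts = lam.parts.filter (2 ≤ ·) +
      Multiset.replicate (n + 1 - (lam.parts.filter (2 ≤ ·)).sum) 1 := by
  have h1 : ∀ i ∈ lam.parts.filter (¬ 2 ≤ ·), i = 1 := fun i hi => by
    have := lam.parts_pos (Multiset.mem_of_mem_filter hi)
    have := (Multiset.mem_filter.1 hi).2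
    omega
  have h2 := Multiset.eq_replicate_card.2 h1
  have h3 := Multiset.filter_add_not (2 ≤ ·) lam.parts
  have h4 := lam.parts_sum
  rw [← h3, h2, Multiset.sum_add, Multiset.sum_replicate] at h4
  conv_lhs => rw [← h3, h2]
  congr 2
  simp at h4 ⊢
  omega

/-- The partitions of the non-vanishing case, in terms of the parts different from `1`. -/
theorem exists_oddDistincts_iff {p : ℕ} (hp : p ≤ n) (lam : Nat.Partition (n + 1)) :
    (∃ lam' ∈ Nat.Partition.oddDistincts (p + 1), 1 ∉ lam'.parts ∧
        lam.parts = lam'.parts + Multiset.replicate (n - p) 1) ↔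
      (lam.parts.filter (2 ≤ ·)).sum = p + 1 ∧ (∀ i ∈ lam.parts.filter (2 ≤ ·), Odd i) ∧
        (lam.parts.filter (2 ≤ ·)).Nodup := by
  have hmem : ∀ lam' : Nat.Partition (p + 1), lam' ∈ Nat.Partition.oddDistincts (p + 1) ↔
      (∀ i ∈ lam'.parts, Odd i) ∧ lam'.parts.Nodup := fun lam' => by
    simp [Nat.Partition.oddDistincts, Nat.Partition.odds, Nat.Partition.restricted,
      Nat.Partition.distincts]
  constructor
  · rintro ⟨lam', h1, h2, h3⟩
    have e : lam.parts.filter (2 ≤ ·) = lam'.parts := by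
      rw [h3, Multiset.filter_add, Multiset.filter_eq_self.2, Multiset.filter_eq_nil.2, add_zero]
      · intro i hi
        rw [Multiset.eq_of_mem_replicate hi]
        omega
      · intro i hi
        have := lam'.parts_pos hi
        have : i ≠ 1 := fun e => h2 (e ▸ hi)
        omega
    rw [e]
    exact ⟨lam'.parts_sum, (hmem lam').1 h1⟩
  · rintro ⟨h1, h2⟩
    refine ⟨⟨lam.parts.filter (2 ≤ ·), fun hi => lam.parts_pos (Multiset.mem_of_mem_filter hi), h1⟩,
      (hmem _).2 h2, fun h => ?_, ?_⟩
    · have := (Multiset.mem_filter.1 h).2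
      omega
    · have := parts_eq_filter_add lam
      rwa [h1, show n + 1 - (p + 1) = n - p by omega] at this

/-- The class of type `lam` is the conjugacy class of a permutation of `{0, …, m - 1}` without fixed
points, where `m` is the sum of the parts of `lam` different from `1`. -/
theorem exists_classA_eq (lam : Nat.Partition (n + 1)) {m : ℕ}
    (hm : (lam.parts.filter (2 ≤ ·)).sum = m) :
    m ≤ n + 1 ∧ ∃ g : Perm {x : Fin (n + 1) // (x : ℕ) < m},
      g.cycleType = lam.parts.filter (2 ≤ ·) ∧ g.support = univ ∧
      classA n lam = {h | IsConj (Perm.ofSubtype g) h} := by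
  have hle : m ≤ n + 1 := by
    have h3 := congrArg Multiset.sum (Multiset.filter_add_not (2 ≤ ·) lam.parts)
    rw [Multiset.sum_add, lam.parts_sum, hm] at h3
    omega
  refine ⟨hle, ?_⟩
  obtain ⟨g, hg⟩ := (Equiv.Perm.exists_with_cycleType_iff
    {x : Fin (n + 1) // (x : ℕ) < m} (m := lam.parts.filter (2 ≤ ·))).2
    ⟨by rw [card_subtype_val_lt hle, hm], fun a ha => (Multiset.mem_filter.1 ha).2⟩
  have hcard : g.support.card = m := by rw [← Perm.sum_cycleType, hg, hm]
  refine ⟨g, hg, eq_univ_of_card _ (by rw [hcard, card_subtype_val_lt hle]), ?_⟩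
  have hpart : (Perm.ofSubtype g).partition.parts = lam.parts := by
    rw [Perm.parts_partition, ← Perm.sum_cycleType, Perm.cycleType_ofSubtype, hg]
    conv_rhs => rw [parts_eq_filter_add lam]
    simp
  ext h
  rw [Set.mem_ofPred_eq, Perm.partition_eq_of_isConj, Nat.Partition.ext_iff, hpart]
  exact eq_comm

theorem centralizer_le_alternating_iff_of_support {m : ℕ}
    {g : Perm {x : Fin (n + 1) // (x : ℕ) < m}} (hg : g.support = univ) :
    Subgroup.centralizer {g} ≤ alternatingGroup {x : Fin (n + 1) // (x : ℕ) < m} ↔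
      (∀ i ∈ g.cycleType, Odd i) ∧ g.cycleType.Nodup := by
  rw [Perm.centralizer_le_alternating_iff, Multiset.nodup_iff_count_le_one]
  refine and_congr_right fun _ => and_iff_right ?_
  rw [Perm.sum_cycleType, hg, card_univ]
  omega

end CycleType

end DynkinCohomology

open DynkinCohomology in
theorem mainTheorem4 (k : Type*) [Field k] [CharZero k] (n p : ℕ) (hn : 1 ≤ n) (hp : p ≤ n)
    (lam : Nat.Partition (n + 1)) :
    ((∃ lam' ∈ Nat.Partition.oddDistincts (p + 1), 1 ∉ lam'.parts ∧
        lam.parts = lam'.parts + Multiset.replicate (n - p) 1) →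
      Module.rank k (DynkinCohomology.HDA k n p lam) = 1) ∧
    ((¬ ∃ lam' ∈ Nat.Partition.oddDistincts (p + 1), 1 ∉ lam'.parts ∧
        lam.parts = lam'.parts + Multiset.replicate (n - p) 1) →
      Module.rank k (DynkinCohomology.HDA k n p lam) = 0) := by
  rw [exists_oddDistincts_iff hp]
  obtain ⟨m, hm⟩ : ∃ m, (lam.parts.filter (2 ≤ ·)).sum = m := ⟨_, rfl⟩
  obtain ⟨hmn, g, hct, hsupp, hclass⟩ := exists_classA_eq lam hm
  have hmoved := ofSubtype_apply_ne_iff hsupp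
  have hcent := centralizer_le_alternating_iff_of_support hsupp
  change (_ → Module.rank k (Cohomology (cochainsA k n (classA n lam)) (differentialA k n) p) = 1) ∧
    (_ → Module.rank k (Cohomology (cochainsA k n (classA n lam)) (differentialA k n) p) = 0)
  rw [hclass, hm, ← hct, ← hcent]
  rcases Multiset.empty_or_exists_mem (lam.parts.filter (2 ≤ ·)) with h0 | ⟨i, hi⟩
  · -- the class of the identity
    have hm0 : m = 0 := by rw [← hm, h0]; rfl
    have hg1 : g = 1 := by rw [← Equiv.Perm.cycleType_eq_zero, hct, h0]
    have hset : {h | IsConj (Equiv.Perm.ofSubtype g) h} = {1} := by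
      ext h
      rw [hg1, map_one, Set.mem_ofPred_eq, isConj_one_right]
      rfl
    rw [hset]
    exact ⟨fun h => absurd h.1 (by omega), fun _ => rank_eq_zero_of_identity⟩
  · have hm2 : 2 ≤ m := by
      have h1 := Multiset.le_sum_of_mem hi
      have h2 := (Multiset.mem_filter.1 hi).2
      omega
    constructor
    · rintro ⟨rfl, hle⟩
      refine rank_eq_one_of_conj hm2 hmn hmoved fun z hz hzg => ?_
      refine Equiv.Perm.mem_alternatingGroup.1 (hle (Subgroup.mem_centralizer_iff.2 ?_))
      intro h hh
      rw [Set.mem_singleton_iff.1 hh]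
      ext x
      have h1 : z (Equiv.Perm.ofSubtype g x.1) = Equiv.Perm.ofSubtype g (z x.1) :=
        congrArg (fun f : Equiv.Perm (Fin (n + 1)) => f x.1) hzg
      rw [Equiv.Perm.ofSubtype_apply_coe,
        Equiv.Perm.ofSubtype_apply_of_mem g ((hz x.1).2 x.2)] at h1
      exact congrArg Fin.val h1.symm
    · intro hnot
      refine rank_eq_zero_of_conj hm2 hmn hmoved fun hmp => ?_
      obtain ⟨z, hz, hz'⟩ := SetLike.not_le_iff_exists.1 fun hle => hnot ⟨hmp, hle⟩
      refine ⟨z, (Int.units_eq_one_or _).resolve_left hz', ?_⟩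
      rw [← map_mul, ← map_mul, Subgroup.mem_centralizer_iff.1 hz g rfl]
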